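/- **Setting.** A monopolist sells $n \ge 1$ goods to one buyer. Before contracting the buyer privately observes $\gamma \in \Gamma = [a,b]$ ($a<b$), drawn from a distribution $G$ with density $g>0$ on $\Gamma$. After contracting the buyer privately observes valuations $\theta \in \Theta = \prod_{j=1}^n [\underline\theta^j,\overline\theta^j]$ ($\underline\theta^j<\overline\theta^j$), drawn from $F(\cdot|\gamma)$ with density $f(\cdot|\gamma)$, where $f$ is continuously differentiable in $(\gamma,\theta)$ on $\Gamma\times\Theta$. Write $F^j(\cdot|\gamma)$ and $f^j(\cdot|\gamma)$ for the marginal distribution function and density of $\theta^j$ given $\gamma$, and $F^j_\gamma$ for $\partial F^j/\partial\gamma$. A mechanism consists of measurable functions $q:\Gamma\times\Theta\to[0,1]^n$, $t_1:\Gamma\to\mathbb R$ and $t_2:\Gamma\times\Theta\to\mathbb R$. It is *feasible* if - (IC1) for all $\gamma \in \Gamma$: $\gamma\in\arg\max_{\gamma'\in\Gamma} \mathbb E_{\theta|\gamma}\big[\max_{\theta'\in\Theta}\, q(\gamma',\theta')\cdot\theta-t_1(\gamma')-t_2(\gamma',\theta')\big]$; - (IC2) for all $\gamma \in \Gamma$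 and $\theta\in\Theta$: $\theta\in\arg\max_{\theta'\in\Theta}\, q(\gamma,\theta')\cdot\theta-t_2(\gamma,\theta')$; - (IR) for all $\gamma \in \Gamma$: $\mathbb E_{\theta|\gamma}[q(\gamma,\theta)\cdot\theta-t_1(\gamma)-t_2(\gamma,\theta)]\ge 0$. A mechanism is *optimal* if it is feasible and maximizes the revenue $\mathbb E_{\gamma,\theta}[t_1(\gamma)+t_2(\gamma,\theta)]$ among all feasible mechanisms. The *one-good problem for good $j$* is the same problem with the single good $j$, whose valuation has density $f^j(\cdot|\gamma)$ on $[\underline\theta^j,\overline\theta^j]$ (the Courty–Li sequential screening problem). Assume that for every $j$ (*marginal-by-marginal regularity*) $f^j>0$ and $F^j_\gamma\le 0$ on $\Gamma\times[\underline\theta^j,\overline\theta^j]$, and that the one-good virtual value $$\phi^j(\gamma,\theta^j)=\theta^j+\frac{F^j_\gamma(\theta^j|\gamma)}{f^j(\theta^j|\gamma)}\,\frac{1-G(\gamma)}{g(\gamma)}$$ is (weakly) increasing in $\gamma$ and single-crossing in $\theta^j$, i.e. $\phi^j(\gamma,x)\ge0$ and $x\le y$ imply $\phi^j(\gamma,y)\ge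 0$. Assume also that $F$ has *invariant dependencies*: the copulas $C(\cdot|\gamma)$ of $F(\cdot|\gamma)$, given by $F(\theta|\gamma)=C(F^1(\theta^1|\gamma),\dots,F^n(\theta^n|\gamma)\,|\,\gamma)$, have a common density $c$ on $[0,1]^n$ that does not depend on $\gamma$. **Theorem (Invariant Dependencies Implies Separability).** It is optimal to sell each good separately with an optimal one-good mechanism: 1. If for each $j$ the mechanism $(q^j,t_1^j,t_2^j)$ is optimal in the one-good problem for good $j$, then the mechanism with allocation $(q^j(\gamma,\theta^j))_{j}$ and payments $\sum_j t_1^j(\gamma)$ and $\sum_j t_2^j(\gamma,\theta^j)$ is optimal in the $n$-good problem. 2. For each $j$ the one-good problem has an optimal mechanism, and there is one with allocation $q^j(\gamma,\theta^j)=\mathbf 1\{\phi^j(\gamma,\theta^j)\ge 0\}$ for all $(\gamma,\theta^j)$. 3. Every optimal mechanism of the $n$-good problem satisfies, for each $j$, $q^j(\gamma,\theta)=\mathbf 1\{\phi^j(\gamma,\theta^j)\ge0\}$ for almost every $(\gamma,\theta)$ (with respect to the joint distribution of $(\gamma,\theta)$) such that $\phi^j(\gamma,\theta^j)\neq 0$.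 -/

import Mathlib

open MeasureTheory Set

noncomputable section

/-- The primitives of an `n`-good sequential screening problem: the interval `[a, b]` of
pre-contractual types, its density `g`, the box `[lo, hi]` of valuation vectors, and the
conditional density `f γ θ` of `θ` given `γ`. -/
structure Environment (n : ℕ) where
  a : ℝ
  b : ℝ
  lo : Fin n → ℝ
  hi : Fin n → ℝ
  g : ℝ → ℝ
  f : ℝ → (Fin n → ℝ) → ℝ

/-- A direct mechanism: allocation `q γ θ`, upfront payment `t1 γ`, and second-period
payment `t2 γ θ`. Only the values at `γ ∈ [a, b]` and `θ ∈ [lo, hi]` matter. -/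
structure Mechanism (n : ℕ) where
  q : ℝ → (Fin n → ℝ) → Fin n → ℝ
  t1 : ℝ → ℝ
  t2 : ℝ → (Fin n → ℝ) → ℝ

namespace Environment

section Basic

variable {n : ℕ} (E : Environment n)

/-- The set of pre-contractual types. -/
def types : Set ℝ := Icc E.a E.b

/-- The set of valuation vectors, `∏ j, [lo j, hi j]`. -/
def values : Set (Fin n → ℝ) := Icc E.lo E.hi

/-- The distribution function of the pre-contractual type. -/
def G (γ : ℝ) : ℝ := ∫ s in E.a..γ, E.g s

/-- The joint conditional distribution function `F(θ|γ)`. -/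
def F (γ : ℝ) (θ : Fin n → ℝ) : ℝ := ∫ y in Icc E.lo θ, E.f γ y

/-- Expectation over `θ` conditional on `γ`. -/
def condExp (γ : ℝ) (h : (Fin n → ℝ) → ℝ) : ℝ := ∫ θ in E.values, h θ * E.f γ θ

/-- `g` is a positive density on `[a, b]`, each `f γ` is a density on the box, and `f` is
continuously differentiable in `(γ, θ)`. -/
structure IsSmooth : Prop where
  a_lt_b : E.a < E.b
  lo_lt_hi : ∀ j, E.lo j < E.hi j
  g_pos : ∀ γ ∈ E.types, 0 < E.g γ
  g_integrable : IntegrableOn E.g E.types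
  g_integral : ∫ γ in E.types, E.g γ = 1
  f_nonneg : ∀ γ ∈ E.types, ∀ θ ∈ E.values, 0 ≤ E.f γ θ
  f_integral : ∀ γ ∈ E.types, ∫ θ in E.values, E.f γ θ = 1
  f_contDiff : ContDiffOn ℝ 1 (fun p : ℝ × (Fin n → ℝ) => E.f p.1 p.2) (E.types ×ˢ E.values)

/-- The expected payoff of a buyer of type `γ` who reports `γ'` and afterwards, knowing `θ`,
makes a best second-period report. -/
def deviationPayoff (M : Mechanism n) (γ γ' : ℝ) : ℝ :=
  E.condExp γ fun θ =>
    ⨆ θ' : E.values, ((∑ i, M.q γ' θ' i * θ i) - M.t1 γ' - M.t2 γ' θ')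

/-- The constraint set of the monopolist's problem. -/
structure Feasible (M : Mechanism n) : Prop where
  q_measurable : Measurable fun p : ℝ × (Fin n → ℝ) => M.q p.1 p.2
  t1_measurable : Measurable M.t1
  t2_measurable : Measurable fun p : ℝ × (Fin n → ℝ) => M.t2 p.1 p.2
  q_mem : ∀ γ ∈ E.types, ∀ θ ∈ E.values, ∀ i, M.q γ θ i ∈ Icc (0 : ℝ) 1
  ic1 : ∀ γ ∈ E.types, ∀ γ' ∈ E.types, E.deviationPayoff M γ γ' ≤ E.deviationPayoff M γ γ
  ic2 : ∀ γ ∈ E.types, ∀ θ ∈ E.values, ∀ θ' ∈ E.values,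
    (∑ i, M.q γ θ' i * θ i) - M.t2 γ θ' ≤ (∑ i, M.q γ θ i * θ i) - M.t2 γ θ
  ir : ∀ γ ∈ E.types,
    0 ≤ E.condExp γ fun θ => (∑ i, M.q γ θ i * θ i) - M.t1 γ - M.t2 γ θ

/-- Expected revenue, `E[t1 γ + t2 γ θ]`. (For feasible mechanisms the integrand is bounded
on the support, so the integrals are genuine.) -/
def revenue (M : Mechanism n) : ℝ :=
  ∫ γ in E.types, E.condExp γ (fun θ => M.t1 γ + M.t2 γ θ) * E.g γ

/-- A revenue-maximizing mechanism. -/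
def IsOptimal (M : Mechanism n) : Prop :=
  E.Feasible M ∧ ∀ M' : Mechanism n, E.Feasible M' → E.revenue M' ≤ E.revenue M

end Basic

section Marginals

variable {n : ℕ} (E : Environment (n + 1))

/-- The marginal conditional density `f^j(x|γ)`: all coordinates but the `j`-th are
integrated out. -/
def margDensity (j : Fin (n + 1)) (γ x : ℝ) : ℝ :=
  ∫ y in Icc (j.removeNth E.lo) (j.removeNth E.hi), E.f γ (j.insertNth x y)

/-- The marginal conditional distribution function `F^j(x|γ)`. -/
def margCDF (j : Fin (n + 1)) (γ x : ℝ) : ℝ := ∫ s in E.lo j..x, E.margDensity j γ s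

/-- The partial derivative `F^j_γ(x|γ)` (one-sided at the end points of `[a, b]`). -/
def margCDFDeriv (j : Fin (n + 1)) (γ x : ℝ) : ℝ :=
  derivWithin (fun s => E.margCDF j s x) E.types γ

/-- The one-good virtual value
`φ^j(γ, x) = x + F^j_γ(x|γ) / f^j(x|γ) * (1 - G(γ)) / g(γ)`. -/
def virtualValue (j : Fin (n + 1)) (γ x : ℝ) : ℝ :=
  x + E.margCDFDeriv j γ x / E.margDensity j γ x * ((1 - E.G γ) / E.g γ)

/-- The regularity condition on the `j`-th marginal: a positive density, first-order
stochastic dominance, and a virtual value that is increasing in `γ` and crosses zero at most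
once, from below, in the valuation. -/
structure IsRegularMarginal (j : Fin (n + 1)) : Prop where
  density_pos : ∀ γ ∈ E.types, ∀ x ∈ Icc (E.lo j) (E.hi j), 0 < E.margDensity j γ x
  deriv_nonpos : ∀ γ ∈ E.types, ∀ x ∈ Icc (E.lo j) (E.hi j), E.margCDFDeriv j γ x ≤ 0
  monotone : ∀ x ∈ Icc (E.lo j) (E.hi j), MonotoneOn (fun γ => E.virtualValue j γ x) E.types
  single_crossing : ∀ γ ∈ E.types, ∀ x ∈ Icc (E.lo j) (E.hi j), ∀ y ∈ Icc (E.lo j) (E.hi j),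
    x ≤ y → 0 ≤ E.virtualValue j γ x → 0 ≤ E.virtualValue j γ y

/-- `c` is a density on `[0, 1]^(n+1)` of the copula `C(·|γ)` of `F(·|γ)`, i.e.
`F(θ|γ) = C(F^1(θ^1|γ), …, F^(n+1)(θ^(n+1)|γ)|γ)` with `C(u|γ) = ∫ v in [0, u], c v`. -/
structure IsCopulaDensity (γ : ℝ) (c : (Fin (n + 1) → ℝ) → ℝ) : Prop where
  nonneg : ∀ u ∈ Icc (0 : Fin (n + 1) → ℝ) 1, 0 ≤ c u
  integrable : IntegrableOn c (Icc (0 : Fin (n + 1) → ℝ) 1)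
  sklar : ∀ θ ∈ E.values, E.F γ θ = ∫ u in Icc 0 (fun j => E.margCDF j γ (θ j)), c u

/-- Invariant dependencies: one and the same copula density for all types `γ`. -/
def InvariantDependencies : Prop :=
  ∃ c : (Fin (n + 1) → ℝ) → ℝ, ∀ γ ∈ E.types, E.IsCopulaDensity γ c

/-- The one-good sequential screening problem for good `j`: the same type distribution, and
valuations distributed according to the `j`-th marginal. -/
def oneGood (j : Fin (n + 1)) : Environment 1 where
  a := E.a
  b := E.b
  lo := fun _ => E.lo j
  hi := fun _ => E.hi j
  g := E.g
  f := fun γ θ => E.margDensity j γ (θ 0)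

end Marginals

end Environment

/-- Offering the one-good mechanisms `M j` side by side: good `j` is allocated according to
`M j` on the basis of `γ` and `θ j` alone, and all payments are added up. -/
def Mechanism.separate {n : ℕ} (M : Fin n → Mechanism 1) : Mechanism n where
  q := fun γ θ j => (M j).q γ (fun _ => θ j) 0
  t1 := fun γ => ∑ j, (M j).t1 γ
  t2 := fun γ θ => ∑ j, (M j).t2 γ (fun _ => θ j)

end

/-!
The proof bounds the revenue of every feasible mechanism by an expected virtual surplus that splits
into one term per good, and shows that each term is attained by a one-good mechanism.

*Transport.* Let `T^j(γ, ·)` be the quantile function of the `j`-th marginal given `γ`. With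
invariant dependencies the conditional law of `θ` given `γ` is the image of one fixed measure `κ`
on the unit cube under `u ↦ (T^j(γ, u^j))_j` (`IsSmooth.map_quantileMap`). The quantiles are
Lipschitz in `γ` with derivative the velocity `-F^j_γ / f^j` (`hasDerivWithinAt_quantile`), which
follows from `F^j(T^j(γ, u)|γ) = u` and the mean value theorem.

*Envelope formula.* Let `U(γ)` be the equilibrium payoff (`rent`). If type `γ` reports `γ'`, then
(IC2), read as a subgradient inequality at the valuations `T(γ', u)`, yields
`U(γ) ≥ U(γ') + ∫ q(γ', T(γ', u)) · (T(γ, u) - T(γ', u)) dκ(u)` (`Feasible.rent_add_le`). So `U` is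
Lipschitz, and since the right-hand side touches `U` from below at `γ'`, wherever `U` is
differentiable its derivative is the expected velocity of the goods sold
(`Feasible.deriv_rent_eq`). No differentiability of the mechanism is needed. Integration by parts
against `G` turns revenue into `-U(a) + ∑ j, E[q^j φ^j]` (`Feasible.revenue_eq`). As `q^j` lies
in `[0, 1]`, this is at most `∑ j, E[max φ^j 0]`.

*Attainment.* For one good, single crossing and monotonicity of `φ^j` in `γ` mean that `φ^j ≥ 0`
describes a cutoff in `θ^j` which falls with `γ`. Offering a menu of options with these strike
prices, with upfront payments that implement the envelope formula and `U(a) = 0`, is feasible: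
first-order stochastic dominance makes a lower strike price more valuable to higher types
(`exists_cutoff_mechanism`). Any one-good mechanism, extended by selling nothing else, is feasible
in the joint problem with the same revenue, so the upper bound also applies to one-good problems
(`revenue_oneGood_eq`), and the revenue of separate sales is the sum of the one-good revenues
(`revenue_separate`). Hence separate sale of optimal one-good mechanisms attains the bound, and an
optimal joint mechanism must satisfy `q^j φ^j = max φ^j 0` almost surely.
-/

open Filter Topology Function

/-! ### Smoothness of the marginal distributions -/

theorem lo_sup_hi_inf_mem_Icc {α : Type*} [Lattice α] {lo hi : α} (h : lo ≤ hi) (x : α) :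
    lo ⊔ hi ⊓ x ∈ Icc lo hi :=
  ⟨le_sup_left, sup_le h inf_le_left⟩

theorem lo_sup_hi_inf_eq_self {α : Type*} [Lattice α] {lo hi x : α} (hx : x ∈ Icc lo hi) :
    lo ⊔ hi ⊓ x = x := by
  rw [inf_eq_right.2 hx.2, sup_eq_right.2 hx.1]

theorem integral_integral_swap_of_continuous {α : Type*} [TopologicalSpace α] [MeasurableSpace α]
    [OpensMeasurableSpace α] [SecondCountableTopology α] {μ : Measure α}
    [IsLocallyFiniteMeasure μ] [SFinite μ]
    {f : ℝ → α → ℝ} (hf : Continuous (uncurry f)) (a b : ℝ) {s : Set α} (hs : IsCompact s)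
    (hsm : MeasurableSet s) :
    ∫ y in s, (∫ x in a..b, f x y) ∂μ = ∫ x in a..b, (∫ y in s, f x y ∂μ) := by
  symm
  apply intervalIntegral_integral_swap
  rw [Measure.prod_restrict]
  have : IntegrableOn (uncurry f) (uIcc a b ×ˢ s) (volume.prod μ) :=
    hf.continuousOn.integrableOn_of_subset_isCompact (isCompact_uIcc.prod hs)
      (measurableSet_uIcc.prod hsm) Subset.rfl (isCompact_uIcc.prod hs).measure_lt_top.ne
  exact this.mono_set (prod_mono uIoc_subset_uIcc Subset.rfl)

namespace Environment

section Smooth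

variable {n : ℕ} {E : Environment n}

theorem IsSmooth.lo_le_hi (hE : E.IsSmooth) : E.lo ≤ E.hi := fun j => (hE.lo_lt_hi j).le

/-- The conditional density is, on its domain, an indefinite integral in the type of a function
that is continuous on the whole space. -/
theorem IsSmooth.exists_eq_integral (hE : E.IsSmooth) :
    ∃ (f₀ : (Fin n → ℝ) → ℝ) (h : ℝ → (Fin n → ℝ) → ℝ), Continuous f₀ ∧ Continuous (uncurry h) ∧
      ∀ γ ∈ E.types, ∀ θ ∈ E.values, E.f γ θ = f₀ θ + ∫ s in E.a..γ, h s θ := by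
  have hab := hE.a_lt_b.le
  have hlh := hE.lo_le_hi
  set D : Set (ℝ × (Fin n → ℝ)) := E.types ×ˢ E.values with hD
  set F : ℝ × (Fin n → ℝ) → ℝ := fun p => E.f p.1 p.2 with hF
  have hu : UniqueDiffOn ℝ D := by
    refine (uniqueDiffOn_Icc hE.a_lt_b).prod ?_
    rw [values, ← Set.pi_univ_Icc]
    exact UniqueDiffOn.univ_pi fun i => uniqueDiffOn_Icc (hE.lo_lt_hi i)
  have hdc : ContinuousOn (fun p => fderivWithin ℝ F D p ((1 : ℝ), (0 : Fin n → ℝ))) D :=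
    (hE.f_contDiff.continuousOn_fderivWithin hu le_rfl).clm_apply continuousOn_const
  let P : ℝ × (Fin n → ℝ) → ℝ × (Fin n → ℝ) := fun p =>
    (E.a ⊔ E.b ⊓ p.1, E.lo ⊔ E.hi ⊓ p.2)
  have hP : Continuous P := by
    have h1 : Continuous fun p : ℝ × (Fin n → ℝ) => E.a ⊔ E.b ⊓ p.1 := by fun_prop
    have h2 : Continuous fun p : ℝ × (Fin n → ℝ) => E.lo ⊔ E.hi ⊓ p.2 := by
      refine continuous_pi fun i => ?_
      simp only [Pi.sup_apply, Pi.inf_apply]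
      fun_prop
    exact h1.prodMk h2
  have hPD : ∀ p, P p ∈ D := fun p =>
    ⟨lo_sup_hi_inf_mem_Icc hab _, lo_sup_hi_inf_mem_Icc hlh _⟩
  have hPid : ∀ p ∈ D, P p = p := fun p hp =>
    Prod.ext (lo_sup_hi_inf_eq_self hp.1) (lo_sup_hi_inf_eq_self hp.2)
  refine ⟨fun θ => F (P (E.a, θ)),
    fun s θ => fderivWithin ℝ F D (P (s, θ)) ((1 : ℝ), (0 : Fin n → ℝ)), ?_, ?_, ?_⟩
  · exact hE.f_contDiff.continuousOn.comp_continuous (hP.comp (by fun_prop)) fun _ => hPD _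
  · exact hdc.comp_continuous hP hPD
  · intro γ hγ θ hθ
    have hc : Continuous fun s : ℝ =>
        fderivWithin ℝ F D (P (s, θ)) ((1 : ℝ), (0 : Fin n → ℝ)) :=
      hdc.comp_continuous (hP.comp (by fun_prop)) fun _ => hPD _
    have hFc : ContinuousOn F D := hE.f_contDiff.continuousOn
    have key := intervalIntegral.integral_eq_sub_of_hasDerivAt_of_le (a := E.a) (b := γ)
      (f := fun s => F (s, θ))
      (f' := fun s => fderivWithin ℝ F D (P (s, θ)) ((1 : ℝ), (0 : Fin n → ℝ)))
      hγ.1 (hFc.comp (by fun_prop) fun s hs => ⟨⟨hs.1, hs.2.trans hγ.2⟩, hθ⟩) ?_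
      (hc.intervalIntegrable _ _)
    · have h1 : P (E.a, θ) = (E.a, θ) := hPid _ ⟨⟨le_rfl, hab⟩, hθ⟩
      beta_reduce
      rw [h1, key]
      simp only [hF]
      ring
    · intro s hs
      have hsD : (s, θ) ∈ D := ⟨⟨hs.1.le, hs.2.le.trans hγ.2⟩, hθ⟩
      have hd : HasFDerivWithinAt F (fderivWithin ℝ F D (s, θ)) D (s, θ) :=
        ((hE.f_contDiff.differentiableOn one_ne_zero) _ hsD).hasFDerivWithinAt
      have hl : HasDerivWithinAt (fun s : ℝ => (s, θ)) ((1 : ℝ), (0 : Fin n → ℝ)) E.types s :=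
        ((hasDerivAt_id s).prodMk (hasDerivAt_const s θ)).hasDerivWithinAt
      have := hd.comp_hasDerivWithinAt s hl fun r hr => (⟨hr, hθ⟩ : (r, θ) ∈ E.types ×ˢ E.values)
      simp only [hPid _ hsD]
      exact this.hasDerivAt (Icc_mem_nhds hs.1 (hs.2.trans_le hγ.2))

end Smooth

section SmoothMarginals

variable {n : ℕ} {E : Environment (n + 1)}

theorem insertNth_mem_values {j : Fin (n + 1)} {x : ℝ} {y : Fin n → ℝ}
    (hx : x ∈ Icc (E.lo j) (E.hi j))
    (hy : y ∈ Icc (j.removeNth E.lo) (j.removeNth E.hi)) : j.insertNth x y ∈ E.values :=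
  Fin.insertNth_mem_Icc.2 ⟨hx, hy⟩

/-- The marginals inherit the smoothness of the joint density: on the domain, `f^j` is continuous
and `F^j` is an indefinite integral in the type of a continuous function. -/
theorem IsSmooth.exists_marg_eq_integral (hE : E.IsSmooth) (j : Fin (n + 1)) :
    ∃ (d Φ : ℝ → ℝ → ℝ) (P : ℝ → ℝ), Continuous (uncurry d) ∧ Continuous (uncurry Φ) ∧
      (∀ γ ∈ E.types, ∀ x ∈ Icc (E.lo j) (E.hi j), E.margDensity j γ x = d γ x) ∧
      ∀ γ ∈ E.types, ∀ x ∈ Icc (E.lo j) (E.hi j),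
        E.margCDF j γ x = P x + ∫ s in E.a..γ, Φ s x := by
  obtain ⟨f₀, h, hf₀, hh, hfh⟩ := hE.exists_eq_integral
  set B : Set (Fin n → ℝ) := Icc (j.removeNth E.lo) (j.removeNth E.hi) with hB
  have hBc : IsCompact B := isCompact_Icc
  have hins : Continuous fun p : ℝ × (Fin n → ℝ) => (j.insertNth p.1 p.2 : Fin (n + 1) → ℝ) :=
    Continuous.finInsertNth j continuous_fst continuous_snd
  have hins' : ∀ x : ℝ, Continuous fun y : Fin n → ℝ => (j.insertNth x y : Fin (n + 1) → ℝ) :=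
    fun x => Continuous.finInsertNth j continuous_const continuous_id
  have hhx : ∀ x : ℝ, Continuous fun p : ℝ × (Fin n → ℝ) =>
      h p.1 (j.insertNth x p.2 : Fin (n + 1) → ℝ) := fun x =>
    hh.comp (continuous_fst.prodMk ((hins' x).comp continuous_snd))
  let m₀ : ℝ → ℝ := fun x => ∫ y in B, f₀ (j.insertNth x y)
  let m₁ : ℝ → ℝ → ℝ := fun s x => ∫ y in B, h s (j.insertNth x y)
  have hm₀ : Continuous m₀ :=
    continuous_parametric_integral_of_continuous (f := fun x y => f₀ (j.insertNth x y))
      (hf₀.comp hins) hBc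
  have hm₁ : Continuous (uncurry m₁) := by
    have : Continuous (uncurry fun (p : ℝ × ℝ) (y : Fin n → ℝ) =>
        h p.1 (j.insertNth p.2 y : Fin (n + 1) → ℝ)) := by
      have h1 : Continuous fun q : (ℝ × ℝ) × (Fin n → ℝ) => (q.1.2, q.2) := by fun_prop
      exact hh.comp ((continuous_fst.comp continuous_fst).prodMk (hins.comp h1))
    exact continuous_parametric_integral_of_continuous this hBc
  have hd : ∀ γ ∈ E.types, ∀ x ∈ Icc (E.lo j) (E.hi j),
      E.margDensity j γ x = m₀ x + ∫ s in E.a..γ, m₁ s x := by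
    intro γ hγ x hx
    have h1 : Continuous fun y : Fin n → ℝ => f₀ (j.insertNth x y) := hf₀.comp (hins' x)
    have h2 : Continuous fun y : Fin n → ℝ => ∫ s in E.a..γ, h s (j.insertNth x y) := by
      apply intervalIntegral.continuous_parametric_intervalIntegral_of_continuous'
      exact (hhx x).comp continuous_swap
    rw [margDensity, setIntegral_congr_fun measurableSet_Icc
      (fun y hy => hfh γ hγ _ (insertNth_mem_values hx hy)),
      integral_add (h1.continuousOn.integrableOn_compact hBc)
        (h2.continuousOn.integrableOn_compact hBc),
      integral_integral_swap_of_continuous (f := fun s y => h s (j.insertNth x y)) (hhx x) _ _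
        hBc measurableSet_Icc]
  refine ⟨fun γ x => m₀ x + ∫ s in E.a..γ, m₁ s x,
    fun s x => ∫ y in E.lo j..x, m₁ s y, fun x => ∫ y in E.lo j..x, m₀ y, ?_, ?_, hd, ?_⟩
  · have h1 : Continuous fun p : ℝ × ℝ => m₀ p.2 := hm₀.comp continuous_snd
    have h2 : Continuous fun p : ℝ × ℝ => ∫ s in E.a..p.1, m₁ s p.2 := by
      apply intervalIntegral.continuous_parametric_intervalIntegral_of_continuous
        (f := fun (p : ℝ × ℝ) s => m₁ s p.2) _ continuous_fst
      exact hm₁.comp (by fun_prop : Continuous fun q : (ℝ × ℝ) × ℝ => (q.2, q.1.2))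
    exact h1.add h2
  · apply intervalIntegral.continuous_parametric_intervalIntegral_of_continuous
      (f := fun (p : ℝ × ℝ) y => m₁ p.1 y) _ continuous_snd
    exact hm₁.comp (by fun_prop : Continuous fun q : (ℝ × ℝ) × ℝ => (q.1.1, q.2))
  · intro γ hγ x hx
    have h2 : Continuous fun y : ℝ => ∫ s in E.a..γ, m₁ s y := by
      apply intervalIntegral.continuous_parametric_intervalIntegral_of_continuous'
      exact hm₁.comp continuous_swap
    have h3 : ∫ y in E.lo j..x, E.margDensity j γ y =
        ∫ y in E.lo j..x, (m₀ y + ∫ s in E.a..γ, m₁ s y) := by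
      apply intervalIntegral.integral_congr
      intro y hy
      rw [uIcc_of_le hx.1] at hy
      exact hd γ hγ y ⟨hy.1, hy.2.trans hx.2⟩
    rw [margCDF, h3, intervalIntegral.integral_add (hm₀.intervalIntegrable _ _)
      (h2.intervalIntegrable _ _)]
    congr 1
    simp only [intervalIntegral.integral_of_le hx.1, ← integral_Icc_eq_integral_Ioc]
    exact integral_integral_swap_of_continuous hm₁ _ _ isCompact_Icc measurableSet_Icc

theorem IsSmooth.margDensity_continuousOn (hE : E.IsSmooth) (j : Fin (n + 1)) :
    ContinuousOn (uncurry (E.margDensity j)) (E.types ×ˢ Icc (E.lo j) (E.hi j)) := by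
  obtain ⟨d, Φ, P, hd, hΦ, h1, h2⟩ := hE.exists_marg_eq_integral j
  exact hd.continuousOn.congr fun p hp => h1 p.1 hp.1 p.2 hp.2

theorem IsSmooth.exists_margCDFDeriv (hE : E.IsSmooth) (j : Fin (n + 1)) :
    ∃ (Φ : ℝ → ℝ → ℝ) (P : ℝ → ℝ), Continuous (uncurry Φ) ∧
      (∀ γ ∈ E.types, ∀ x ∈ Icc (E.lo j) (E.hi j),
        HasDerivWithinAt (fun s => E.margCDF j s x) (Φ γ x) E.types γ) ∧
      (∀ γ ∈ E.types, ∀ x ∈ Icc (E.lo j) (E.hi j), E.margCDFDeriv j γ x = Φ γ x) ∧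
      ∀ γ ∈ E.types, ∀ x ∈ Icc (E.lo j) (E.hi j),
        E.margCDF j γ x = P x + ∫ s in E.a..γ, Φ s x := by
  obtain ⟨d, Φ, P, hd, hΦ, h1, h2⟩ := hE.exists_marg_eq_integral j
  have key : ∀ γ ∈ E.types, ∀ x ∈ Icc (E.lo j) (E.hi j),
      HasDerivWithinAt (fun s => E.margCDF j s x) (Φ γ x) E.types γ := by
    intro γ hγ x hx
    have hc : Continuous fun s => Φ s x := hΦ.comp (by fun_prop : Continuous fun s => (s, x))
    have h3 : HasDerivAt (fun γ => P x + ∫ s in E.a..γ, Φ s x) (Φ γ x) γ :=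
      (hc.integral_hasStrictDerivAt E.a γ).hasDerivAt.const_add _
    exact h3.hasDerivWithinAt.congr (fun s hs => h2 s hs x hx) (h2 γ hγ x hx)
  exact ⟨Φ, P, hΦ, key, fun γ hγ x hx =>
    (key γ hγ x hx).derivWithin (uniqueDiffOn_Icc hE.a_lt_b _ hγ), h2⟩

theorem IsSmooth.hasDerivWithinAt_margCDF (hE : E.IsSmooth) (j : Fin (n + 1)) {γ x : ℝ}
    (hγ : γ ∈ E.types) (hx : x ∈ Icc (E.lo j) (E.hi j)) :
    HasDerivWithinAt (fun s => E.margCDF j s x) (E.margCDFDeriv j γ x) E.types γ := by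
  obtain ⟨Φ, P, hΦ, h1, h2, -⟩ := hE.exists_margCDFDeriv j
  rw [h2 γ hγ x hx]
  exact h1 γ hγ x hx

theorem IsSmooth.margCDFDeriv_continuousOn (hE : E.IsSmooth) (j : Fin (n + 1)) :
    ContinuousOn (uncurry (E.margCDFDeriv j)) (E.types ×ˢ Icc (E.lo j) (E.hi j)) := by
  obtain ⟨Φ, P, hΦ, h1, h2, -⟩ := hE.exists_margCDFDeriv j
  exact hΦ.continuousOn.congr fun p hp => h2 p.1 hp.1 p.2 hp.2

/-- Fubini's theorem on the box, with the `j`-th coordinate as the outer variable. -/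
theorem integral_values_eq (j : Fin (n + 1)) {h : (Fin (n + 1) → ℝ) → ℝ}
    (hh : IntegrableOn h E.values) :
    ∫ θ in E.values, h θ = ∫ x in Icc (E.lo j) (E.hi j),
      ∫ y in Icc (j.removeNth E.lo) (j.removeNth E.hi), h (j.insertNth x y) := by
  set e := (MeasurableEquiv.piFinSuccAbove (fun _ : Fin (n + 1) => ℝ) j).symm with he
  have hmp : MeasurePreserving e :=
    (volume_preserving_piFinSuccAbove (fun _ : Fin (n + 1) => ℝ) j).symm _
  have hpre : e ⁻¹' E.values =
      Icc (E.lo j) (E.hi j) ×ˢ Icc (j.removeNth E.lo) (j.removeNth E.hi) :=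
    ((Fin.insertNthOrderIso (fun _ => ℝ) j).preimage_Icc _ _).trans (Icc_prod_eq _ _)
  rw [← hmp.setIntegral_preimage_emb e.measurableEmbedding, hpre, Measure.volume_eq_prod,
    setIntegral_prod]
  · rfl
  · rw [← Measure.volume_eq_prod, ← hpre]
    exact (hmp.integrableOn_comp_preimage e.measurableEmbedding).2 hh

theorem condExp_coord_eq (j : Fin (n + 1)) {γ : ℝ} {k : ℝ → ℝ}
    (hk : IntegrableOn (fun θ => k (θ j) * E.f γ θ) E.values) :
    E.condExp γ (fun θ => k (θ j)) =
      ∫ x in Icc (E.lo j) (E.hi j), k x * E.margDensity j γ x := by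
  rw [condExp, integral_values_eq j hk]
  simp only [Fin.insertNth_apply_same, integral_const_mul, margDensity]

theorem IsSmooth.f_continuousOn (hE : E.IsSmooth) {γ : ℝ} (hγ : γ ∈ E.types) :
    ContinuousOn (E.f γ) E.values :=
  hE.f_contDiff.continuousOn.comp (f := fun θ : Fin (n + 1) → ℝ => (γ, θ)) (by fun_prop)
    fun _ hθ => ⟨hγ, hθ⟩

theorem IsSmooth.margDensity_continuousOn_right (hE : E.IsSmooth) (j : Fin (n + 1)) {γ : ℝ}
    (hγ : γ ∈ E.types) : ContinuousOn (E.margDensity j γ) (Icc (E.lo j) (E.hi j)) :=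
  (hE.margDensity_continuousOn j).comp (f := fun x : ℝ => (γ, x)) (by fun_prop)
    fun _ hx => ⟨hγ, hx⟩

theorem IsSmooth.margDensity_intervalIntegrable (hE : E.IsSmooth) (j : Fin (n + 1)) {γ x y : ℝ}
    (hγ : γ ∈ E.types) (hx : x ∈ Icc (E.lo j) (E.hi j)) (hy : y ∈ Icc (E.lo j) (E.hi j)) :
    IntervalIntegrable (E.margDensity j γ) volume x y :=
  ((hE.margDensity_continuousOn_right j hγ).mono (uIcc_subset_Icc hx hy)).intervalIntegrable

theorem margCDF_lo (j : Fin (n + 1)) (γ : ℝ) : E.margCDF j γ (E.lo j) = 0 := by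
  simp [margCDF]

theorem IsSmooth.margCDF_hi (hE : E.IsSmooth) (j : Fin (n + 1)) {γ : ℝ} (hγ : γ ∈ E.types) :
    E.margCDF j γ (E.hi j) = 1 := by
  rw [margCDF, intervalIntegral.integral_of_le (hE.lo_lt_hi j).le, ← integral_Icc_eq_integral_Ioc,
    ← hE.f_integral γ hγ,
    integral_values_eq j ((hE.f_continuousOn hγ).integrableOn_compact isCompact_Icc)]
  rfl

theorem IsSmooth.margCDF_sub (hE : E.IsSmooth) (j : Fin (n + 1)) {γ x y : ℝ}
    (hγ : γ ∈ E.types) (hx : x ∈ Icc (E.lo j) (E.hi j)) (hy : y ∈ Icc (E.lo j) (E.hi j)) :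
    E.margCDF j γ y - E.margCDF j γ x = ∫ s in x..y, E.margDensity j γ s := by
  have hl : E.lo j ∈ Icc (E.lo j) (E.hi j) := ⟨le_rfl, (hE.lo_lt_hi j).le⟩
  exact intervalIntegral.integral_interval_sub_left
    (hE.margDensity_intervalIntegrable j hγ hl hy) (hE.margDensity_intervalIntegrable j hγ hl hx)

theorem IsSmooth.margCDF_continuousOn (hE : E.IsSmooth) (j : Fin (n + 1)) {γ : ℝ}
    (hγ : γ ∈ E.types) : ContinuousOn (E.margCDF j γ) (Icc (E.lo j) (E.hi j)) := by
  have h := (hE.margDensity_continuousOn_right j hγ).integrableOn_compact (μ := volume)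
    isCompact_Icc
  rw [← uIcc_of_le (hE.lo_lt_hi j).le] at h ⊢
  exact intervalIntegral.continuousOn_primitive_interval h

end SmoothMarginals

end Environment

/-! ### Conditional quantiles -/

namespace Environment

section Quantile

variable {n : ℕ} {E : Environment (n + 1)} {j : Fin (n + 1)}

theorem IsSmooth.lo_mem (hE : E.IsSmooth) (j : Fin (n + 1)) : E.lo j ∈ Icc (E.lo j) (E.hi j) :=
  ⟨le_rfl, (hE.lo_lt_hi j).le⟩

theorem IsSmooth.hi_mem (hE : E.IsSmooth) (j : Fin (n + 1)) : E.hi j ∈ Icc (E.lo j) (E.hi j) :=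
  ⟨(hE.lo_lt_hi j).le, le_rfl⟩

theorem IsSmooth.exists_margCDF_sub_eq_mul (hE : E.IsSmooth) (j : Fin (n + 1)) {γ x y : ℝ}
    (hγ : γ ∈ E.types) (hx : x ∈ Icc (E.lo j) (E.hi j)) (hy : y ∈ Icc (E.lo j) (E.hi j)) :
    ∃ ξ ∈ uIcc x y, E.margCDF j γ y - E.margCDF j γ x = E.margDensity j γ ξ * (y - x) := by
  obtain ⟨ξ, hξ, h⟩ := exists_eq_const_mul_intervalIntegral_of_nonneg (μ := volume)
    (f := E.margDensity j γ) (g := fun _ => 1) (a := x) (b := y)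
    ((hE.margDensity_continuousOn_right j hγ).mono (uIcc_subset_Icc hx hy))
    (intervalIntegrable_const) (fun _ _ => zero_le_one)
  refine ⟨ξ, hξ, ?_⟩
  rw [hE.margCDF_sub j hγ hx hy]
  simpa using h

theorem IsSmooth.margCDF_strictMonoOn (hE : E.IsSmooth) (hreg : E.IsRegularMarginal j) {γ : ℝ}
    (hγ : γ ∈ E.types) : StrictMonoOn (E.margCDF j γ) (Icc (E.lo j) (E.hi j)) := by
  intro x hx y hy hxy
  obtain ⟨ξ, hξ, h⟩ := hE.exists_margCDF_sub_eq_mul j hγ hx hy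
  have := mul_pos (hreg.density_pos γ hγ ξ (uIcc_subset_Icc hx hy hξ)) (sub_pos.2 hxy)
  linarith

theorem IsSmooth.margCDF_mem (hE : E.IsSmooth) (hreg : E.IsRegularMarginal j) {γ x : ℝ}
    (hγ : γ ∈ E.types) (hx : x ∈ Icc (E.lo j) (E.hi j)) : E.margCDF j γ x ∈ Icc (0 : ℝ) 1 := by
  have hm := (hE.margCDF_strictMonoOn hreg hγ).monotoneOn
  constructor
  · rw [← E.margCDF_lo j γ]
    exact hm (hE.lo_mem j) hx hx.1
  · rw [← hE.margCDF_hi j hγ]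
    exact hm hx (hE.hi_mem j) hx.2

variable (E j) in
/-- The quantile function of the `j`-th marginal given `γ`. The upper end point is inserted so
that the function takes values in `[lo j, hi j]` and is monotone on the whole line. -/
noncomputable def quantile (γ u : ℝ) : ℝ :=
  sInf (insert (E.hi j) {x ∈ Icc (E.lo j) (E.hi j) | u ≤ E.margCDF j γ x})

theorem quantile_set_subset (hE : E.IsSmooth) (γ u : ℝ) :
    insert (E.hi j) {x ∈ Icc (E.lo j) (E.hi j) | u ≤ E.margCDF j γ x} ⊆
      Icc (E.lo j) (E.hi j) :=
  insert_subset (hE.hi_mem j) (sep_subset _ _)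

theorem quantile_mem (hE : E.IsSmooth) (γ u : ℝ) :
    E.quantile j γ u ∈ Icc (E.lo j) (E.hi j) := by
  have hb : BddBelow (insert (E.hi j) {x ∈ Icc (E.lo j) (E.hi j) | u ≤ E.margCDF j γ x}) :=
    bddBelow_Icc.mono (quantile_set_subset hE γ u)
  exact ⟨le_csInf (insert_nonempty _ _) fun x hx => (quantile_set_subset hE γ u hx).1,
    csInf_le hb (mem_insert _ _)⟩

theorem quantile_monotone (hE : E.IsSmooth) (γ : ℝ) : Monotone (E.quantile j γ) := by
  intro u v huv
  exact csInf_le_csInf (bddBelow_Icc.mono (quantile_set_subset hE γ u)) (insert_nonempty _ _)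
    (insert_subset_insert fun x hx => ⟨hx.1, huv.trans hx.2⟩)

theorem le_margCDF_quantile (hE : E.IsSmooth) {γ u : ℝ} (hγ : γ ∈ E.types) (hu : u ≤ 1) :
    u ≤ E.margCDF j γ (E.quantile j γ u) := by
  have hset : insert (E.hi j) {x ∈ Icc (E.lo j) (E.hi j) | u ≤ E.margCDF j γ x} =
      {x ∈ Icc (E.lo j) (E.hi j) | u ≤ E.margCDF j γ x} := by
    apply insert_eq_of_mem
    refine ⟨hE.hi_mem j, ?_⟩
    rwa [hE.margCDF_hi j hγ]
  have hclosed : IsClosed {x ∈ Icc (E.lo j) (E.hi j) | u ≤ E.margCDF j γ x} :=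
    (hE.margCDF_continuousOn j hγ).preimage_isClosed_of_isClosed isClosed_Icc isClosed_Ici
  have hmem := hclosed.csInf_mem (hset ▸ insert_nonempty _ _)
    (bddBelow_Icc.mono (sep_subset _ _))
  rw [← hset] at hmem
  change E.quantile j γ u ∈ _ at hmem
  rw [hset] at hmem
  exact hmem.2

theorem quantile_le_iff (hE : E.IsSmooth) (hreg : E.IsRegularMarginal j) {γ u x : ℝ}
    (hγ : γ ∈ E.types) (hu : u ≤ 1) (hx : x ∈ Icc (E.lo j) (E.hi j)) :
    E.quantile j γ u ≤ x ↔ u ≤ E.margCDF j γ x := by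
  refine ⟨fun h => (le_margCDF_quantile hE hγ hu).trans
    ((hE.margCDF_strictMonoOn hreg hγ).monotoneOn (quantile_mem hE γ u) hx h), fun h => ?_⟩
  exact csInf_le (bddBelow_Icc.mono (quantile_set_subset hE γ u)) (mem_insert_of_mem _ ⟨hx, h⟩)

theorem margCDF_quantile (hE : E.IsSmooth) (hreg : E.IsRegularMarginal j) {γ u : ℝ}
    (hγ : γ ∈ E.types) (hu : u ∈ Icc (0 : ℝ) 1) : E.margCDF j γ (E.quantile j γ u) = u := by
  refine le_antisymm ?_ (le_margCDF_quantile hE hγ hu.2)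
  have hivt := intermediate_value_Icc (hE.lo_lt_hi j).le (hE.margCDF_continuousOn j hγ)
  rw [margCDF_lo, hE.margCDF_hi j hγ] at hivt
  obtain ⟨x, hx, hxu⟩ := hivt hu
  have h := (quantile_le_iff hE hreg hγ hu.2 hx).2 hxu.ge
  exact hxu ▸ (hE.margCDF_strictMonoOn hreg hγ).monotoneOn (quantile_mem hE γ u) hx h

theorem exists_density_lower_bound (hE : E.IsSmooth) (hreg : E.IsRegularMarginal j) :
    ∃ m > 0, ∀ γ ∈ E.types, ∀ x ∈ Icc (E.lo j) (E.hi j), m ≤ E.margDensity j γ x := by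
  have hc : IsCompact (E.types ×ˢ Icc (E.lo j) (E.hi j)) := isCompact_Icc.prod isCompact_Icc
  obtain ⟨p, hp, hmin⟩ := hc.exists_isMinOn
    ⟨(E.a, E.lo j), ⟨le_rfl, hE.a_lt_b.le⟩, hE.lo_mem j⟩ (hE.margDensity_continuousOn j)
  exact ⟨_, hreg.density_pos p.1 hp.1 p.2 hp.2, fun γ hγ x hx => hmin (mk_mem_prod hγ hx)⟩

theorem exists_deriv_upper_bound (hE : E.IsSmooth) (j : Fin (n + 1)) :
    ∃ C, 0 ≤ C ∧ ∀ γ ∈ E.types, ∀ x ∈ Icc (E.lo j) (E.hi j), |E.margCDFDeriv j γ x| ≤ C := by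
  have hc : IsCompact (E.types ×ˢ Icc (E.lo j) (E.hi j)) := isCompact_Icc.prod isCompact_Icc
  obtain ⟨C, hC⟩ := hc.exists_bound_of_continuousOn (hE.margCDFDeriv_continuousOn j)
  exact ⟨|C|, abs_nonneg _, fun γ hγ x hx => (hC (γ, x) (mk_mem_prod hγ hx)).trans (le_abs_self C)⟩

/-- Quantiles are Lipschitz in the type, uniformly in the level. -/
theorem exists_quantile_lipschitz (hE : E.IsSmooth) (hreg : E.IsRegularMarginal j) :
    ∃ K, 0 ≤ K ∧ ∀ γ ∈ E.types, ∀ γ' ∈ E.types, ∀ u ∈ Icc (0 : ℝ) 1,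
      |E.quantile j γ u - E.quantile j γ' u| ≤ K * |γ - γ'| := by
  obtain ⟨m, hm, hmd⟩ := exists_density_lower_bound hE hreg
  obtain ⟨C, hC, hCd⟩ := exists_deriv_upper_bound hE j
  refine ⟨C / m, by positivity, fun γ hγ γ' hγ' u hu => ?_⟩
  have hx := quantile_mem (j := j) hE γ u
  have hy := quantile_mem (j := j) hE γ' u
  obtain ⟨ξ, hξ, h⟩ := hE.exists_margCDF_sub_eq_mul j hγ' hy hx
  rw [margCDF_quantile hE hreg hγ' hu] at h
  have h2 : |E.margCDF j γ' (E.quantile j γ u) - E.margCDF j γ (E.quantile j γ u)| ≤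
      C * |γ' - γ| :=
    Convex.norm_image_sub_le_of_norm_hasDerivWithin_le
      (f := fun s => E.margCDF j s (E.quantile j γ u))
      (fun s hs => hE.hasDerivWithinAt_margCDF j hs hx) (fun s hs => hCd s hs _ hx)
      (convex_Icc _ _) hγ hγ'
  rw [margCDF_quantile hE hreg hγ hu, h, abs_mul, abs_sub_comm γ'] at h2
  have h3 := hmd γ' hγ' ξ (uIcc_subset_Icc hy hx hξ)
  have h4 : m * |E.quantile j γ u - E.quantile j γ' u| ≤ C * |γ - γ'| :=
    (mul_le_mul_of_nonneg_right (h3.trans (le_abs_self _)) (abs_nonneg _)).trans h2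
  rw [div_mul_eq_mul_div, le_div_iff₀ hm]
  linarith

variable (E j) in
/-- The velocity `-F^j_γ / f^j` at which the quantile of the `j`-th marginal that sits at `x`
moves with the type. -/
noncomputable def velocity (γ x : ℝ) : ℝ := -(E.margCDFDeriv j γ x / E.margDensity j γ x)

theorem hasDerivWithinAt_quantile (hE : E.IsSmooth) (hreg : E.IsRegularMarginal j) {γ u : ℝ}
    (hγ : γ ∈ E.types) (hu : u ∈ Icc (0 : ℝ) 1) :
    HasDerivWithinAt (fun s => E.quantile j s u) (E.velocity j γ (E.quantile j γ u)) E.types γ := by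
  set x := E.quantile j γ u with hxdef
  have hx : x ∈ Icc (E.lo j) (E.hi j) := quantile_mem hE γ u
  have hex : ∀ s, ∃ ξ, s ∈ E.types → ξ ∈ uIcc x (E.quantile j s u) ∧
      E.margCDF j s (E.quantile j s u) - E.margCDF j s x =
        E.margDensity j s ξ * (E.quantile j s u - x) := by
    intro s
    by_cases hs : s ∈ E.types
    · obtain ⟨ξ, hξ, h⟩ := hE.exists_margCDF_sub_eq_mul j hs hx (quantile_mem hE s u)
      exact ⟨ξ, fun _ => ⟨hξ, h⟩⟩
    · exact ⟨0, fun h => (hs h).elim⟩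
  choose ξ hξ using hex
  obtain ⟨K, hK, hlip⟩ := exists_quantile_lipschitz hE hreg
  have hξmem : ∀ s ∈ E.types, ξ s ∈ Icc (E.lo j) (E.hi j) := fun s hs =>
    uIcc_subset_Icc hx (quantile_mem hE s u) (hξ s hs).1
  have hξt : Tendsto ξ (𝓝[E.types] γ) (𝓝 x) := by
    rw [tendsto_iff_dist_tendsto_zero]
    have h0 : Tendsto (fun s => K * |s - γ|) (𝓝[E.types] γ) (𝓝 0) := by
      have : Continuous fun s => K * |s - γ| := by fun_prop
      simpa using (this.tendsto γ).mono_left nhdsWithin_le_nhds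
    refine squeeze_zero' (Eventually.of_forall fun _ => dist_nonneg) ?_ h0
    filter_upwards [self_mem_nhdsWithin] with s hs
    rw [Real.dist_eq]
    exact (abs_sub_left_of_mem_uIcc (hξ s hs).1).trans (hlip s hs γ hγ u hu)
  have hpair : Tendsto (fun s => (s, ξ s)) (𝓝[E.types] γ)
      (𝓝[E.types ×ˢ Icc (E.lo j) (E.hi j)] (γ, x)) := by
    refine tendsto_nhdsWithin_iff.2 ⟨?_, ?_⟩
    · exact (tendsto_id.mono_left nhdsWithin_le_nhds).prodMk_nhds hξt
    · filter_upwards [self_mem_nhdsWithin] with s hs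
      exact mk_mem_prod hs (hξmem s hs)
  have hdens : Tendsto (fun s => E.margDensity j s (ξ s)) (𝓝[E.types] γ)
      (𝓝 (E.margDensity j γ x)) :=
    (hE.margDensity_continuousOn j (γ, x) (mk_mem_prod hγ hx)).tendsto.comp hpair
  have hpos := hreg.density_pos γ hγ x hx
  have hslope := hasDerivWithinAt_iff_tendsto_slope.1 (hE.hasDerivWithinAt_margCDF j hγ hx)
  rw [hasDerivWithinAt_iff_tendsto_slope]
  have hlim := (hslope.div (hdens.mono_left (nhdsWithin_mono _ sdiff_subset)) hpos.ne').neg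
  refine hlim.congr' ?_
  filter_upwards [self_mem_nhdsWithin] with s hs
  have h1 := (hξ s hs.1).2
  rw [margCDF_quantile hE hreg hs.1 hu] at h1
  have h2 : E.margCDF j γ x = u := margCDF_quantile hE hreg hγ hu
  have h3 := (hreg.density_pos s hs.1 _ (hξmem s hs.1)).ne'
  have h4 : s - γ ≠ 0 := sub_ne_zero.2 hs.2
  simp only [slope_def_field, Pi.div_apply, ← hxdef]
  rw [h2, ← mul_right_inj' h3]
  field_simp
  linarith

end Quantile

end Environment

/-! ### The conditional law of the valuations as a transported copula -/

theorem withDensity_ofReal_apply {α : Type*} [MeasurableSpace α] {μ : Measure α} {ρ : α → ℝ}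
    {A B : Set α} (hA : MeasurableSet A) (hAB : A ⊆ B)
    (hρ : IntegrableOn ρ B μ) (hρ0 : ∀ x ∈ B, 0 ≤ ρ x) :
    (μ.restrict B).withDensity (fun x => ENNReal.ofReal (ρ x)) A =
      ENNReal.ofReal (∫ x in A, ρ x ∂μ) := by
  rw [withDensity_apply _ hA, Measure.restrict_restrict hA, inter_eq_left.2 hAB,
    ofReal_integral_eq_lintegral_ofReal (hρ.mono_set hAB)]
  exact (ae_restrict_iff' hA).2 (ae_of_all _ fun x hx => hρ0 x (hAB hx))

theorem ae_withDensity_restrict_mem {α : Type*} [MeasurableSpace α] {μ : Measure α}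
    {ρ : α → ENNReal} {B : Set α} (hB : MeasurableSet B) :
    ∀ᵐ x ∂(μ.restrict B).withDensity ρ, x ∈ B :=
  (withDensity_absolutelyContinuous _ _).ae_le (ae_restrict_mem hB)

/-- Finite measures on `ℝ^ι` are determined by their multivariate distribution functions. -/
theorem measure_pi_ext_of_Iic {ι : Type*} [Fintype ι] {μ ν : Measure (ι → ℝ)} [IsFiniteMeasure μ]
    (huniv : μ univ = ν univ) (h : ∀ x, μ (Iic x) = ν (Iic x)) : μ = ν := by
  have hspan : IsCountablySpanning (range (Iic : ℝ → Set ℝ)) :=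
    ⟨fun k : ℕ => Iic (k : ℝ), fun k => ⟨_, rfl⟩,
      eq_univ_of_forall fun x => mem_iUnion.2 (exists_nat_ge x)⟩
  refine ext_of_generate_finite (Set.pi univ '' Set.pi univ fun _ : ι => range (Iic : ℝ → Set ℝ))
    ?_ (IsPiSystem.pi fun _ => by simpa using isPiSystem_image_Iic (univ : Set ℝ)) ?_ huniv
  · refine (generateFrom_eq_pi (fun _ => ?_) fun _ => hspan).symm
    rw [← borel_eq_generateFrom_Iic ℝ]
    exact (BorelSpace.measurable_eq (α := ℝ)).symm
  · rintro _ ⟨s, hs, rfl⟩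
    choose x hx using fun i => hs i (mem_univ i)
    simp only [← funext hx]
    rw [Set.pi_univ_Iic]
    exact h x

namespace Environment

section Law

variable {n : ℕ} (E : Environment n)

/-- The conditional law of the valuation vector given `γ`. -/
noncomputable def law (γ : ℝ) : Measure (Fin n → ℝ) :=
  (volume.restrict E.values).withDensity fun θ => ENNReal.ofReal (E.f γ θ)

variable {E}

theorem measurableSet_values : MeasurableSet E.values := measurableSet_Icc

theorem IsSmooth.f_integrableOn (hE : E.IsSmooth) {γ : ℝ} (hγ : γ ∈ E.types) :
    IntegrableOn (E.f γ) E.values := by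
  -- The integral of a function that is not integrable would be `0`, not `1`.
  by_contra h
  have := hE.f_integral γ hγ
  rw [integral_undef h] at this
  exact zero_ne_one this

theorem IsSmooth.isProbabilityMeasure_law (hE : E.IsSmooth) {γ : ℝ} (hγ : γ ∈ E.types) :
    IsProbabilityMeasure (E.law γ) := by
  refine ⟨?_⟩
  have h := withDensity_ofReal_apply measurableSet_values Subset.rfl
    (hE.f_integrableOn hγ) (hE.f_nonneg γ hγ)
  rw [hE.f_integral γ hγ, ENNReal.ofReal_one] at h
  rw [← h]
  refine measure_congr ?_
  filter_upwards [ae_withDensity_restrict_mem (measurableSet_values (E := E))] with θ hθ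
  exact (eq_true hθ).symm

theorem ae_law_mem_values {γ : ℝ} : ∀ᵐ θ ∂E.law γ, θ ∈ E.values :=
  ae_withDensity_restrict_mem measurableSet_values

theorem IsSmooth.condExp_eq_integral_law (hE : E.IsSmooth) {γ : ℝ} (hγ : γ ∈ E.types)
    (h : (Fin n → ℝ) → ℝ) : E.condExp γ h = ∫ θ, h θ ∂E.law γ := by
  rw [law, integral_withDensity_eq_integral_toReal_smul₀
    (hE.f_integrableOn hγ).1.aemeasurable.ennreal_ofReal
    (ae_of_all _ fun _ => ENNReal.ofReal_lt_top)]
  refine setIntegral_congr_fun measurableSet_values fun θ hθ => ?_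
  simp only [ENNReal.toReal_ofReal (hE.f_nonneg γ hγ θ hθ), smul_eq_mul, mul_comm]

theorem IsSmooth.integrable_law_iff (hE : E.IsSmooth) {γ : ℝ} (hγ : γ ∈ E.types)
    {h : (Fin n → ℝ) → ℝ} :
    Integrable h (E.law γ) ↔ IntegrableOn (fun θ => h θ * E.f γ θ) E.values := by
  rw [law, integrable_withDensity_iff_integrable_smul₀'
    (hE.f_integrableOn hγ).1.aemeasurable.ennreal_ofReal
    (ae_of_all _ fun _ => ENNReal.ofReal_lt_top)]
  refine integrableOn_congr_fun (fun θ hθ => ?_) measurableSet_values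
  simp only [ENNReal.toReal_ofReal (hE.f_nonneg γ hγ θ hθ), smul_eq_mul, mul_comm]

end Law

section Transport

variable {n : ℕ} {E : Environment (n + 1)}

/-- The measure on the unit cube with density `c`. -/
noncomputable def copulaLaw {m : ℕ} (c : (Fin m → ℝ) → ℝ) : Measure (Fin m → ℝ) :=
  (volume.restrict (Icc 0 1)).withDensity fun u => ENNReal.ofReal (c u)

theorem ae_copulaLaw_mem {m : ℕ} {c : (Fin m → ℝ) → ℝ} :
    ∀ᵐ u ∂copulaLaw c, u ∈ Icc (0 : Fin m → ℝ) 1 :=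
  ae_withDensity_restrict_mem measurableSet_Icc

variable (E) in
/-- The coordinatewise quantile transform of the unit cube into the box of valuations. -/
noncomputable def quantileMap (γ : ℝ) (u : Fin (n + 1) → ℝ) : Fin (n + 1) → ℝ :=
  fun j => E.quantile j γ (u j)

theorem IsSmooth.measurable_quantileMap (hE : E.IsSmooth) (γ : ℝ) :
    Measurable (E.quantileMap γ) :=
  measurable_pi_iff.2 fun j => (quantile_monotone hE γ).measurable.comp (measurable_pi_apply j)

theorem IsSmooth.quantileMap_mem (hE : E.IsSmooth) (γ : ℝ) (u : Fin (n + 1) → ℝ) :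
    E.quantileMap γ u ∈ E.values :=
  ⟨fun j => (quantile_mem hE γ (u j)).1, fun j => (quantile_mem hE γ (u j)).2⟩

/-- Sklar's theorem as a statement about measures: quantile transforms carry the law with density
`c` on the cube to the conditional law of the valuations. -/
theorem IsSmooth.map_quantileMap (hE : E.IsSmooth) (hreg : ∀ j, E.IsRegularMarginal j) {γ : ℝ}
    (hγ : γ ∈ E.types) {c : (Fin (n + 1) → ℝ) → ℝ} (hc : E.IsCopulaDensity γ c) :
    (copulaLaw c).map (E.quantileMap γ) = E.law γ := by
  have hT := hE.measurable_quantileMap γ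
  have := hE.isProbabilityMeasure_law hγ
  have hbox : ∀ θ ∈ E.values, copulaLaw c (Icc 0 fun j => E.margCDF j γ (θ j)) =
      E.law γ (Icc E.lo θ) := by
    intro θ hθ
    rw [copulaLaw, law, withDensity_ofReal_apply measurableSet_Icc
      (Icc_subset_Icc_right fun j => (hE.margCDF_mem (hreg j) hγ ⟨hθ.1 j, hθ.2 j⟩).2)
      hc.integrable hc.nonneg,
      withDensity_ofReal_apply (B := E.values) measurableSet_Icc
      (Icc_subset_Icc_right hθ.2) (hE.f_integrableOn hγ) (hE.f_nonneg γ hγ), ← hc.sklar θ hθ]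
    rfl
  have huniv : copulaLaw c univ = E.law γ univ := by
    have h := hbox E.hi ⟨hE.lo_le_hi, le_rfl⟩
    have h1 : (fun j => E.margCDF j γ (E.hi j)) = (1 : Fin (n + 1) → ℝ) :=
      funext fun j => hE.margCDF_hi j hγ
    rw [h1] at h
    calc copulaLaw c univ = copulaLaw c (Icc 0 1) := measure_congr <| by
          filter_upwards [ae_copulaLaw_mem (c := c)] with u hu
          exact (eq_true hu).symm
      _ = E.law γ (Icc E.lo E.hi) := h
      _ = E.law γ univ := measure_congr <| by
          filter_upwards [ae_law_mem_values (E := E) (γ := γ)] with θ hθ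
          exact eq_true hθ
  have : IsFiniteMeasure ((copulaLaw c).map (E.quantileMap γ)) := by
    refine ⟨?_⟩
    rw [Measure.map_apply hT MeasurableSet.univ, preimage_univ, huniv]
    exact measure_lt_top _ _
  refine measure_pi_ext_of_Iic ?_ fun x => ?_
  · rw [Measure.map_apply hT MeasurableSet.univ, preimage_univ, huniv]
  rw [Measure.map_apply hT measurableSet_Iic]
  by_cases hx : E.lo ≤ x
  · have hx' : x ⊓ E.hi ∈ E.values := ⟨le_inf hx hE.lo_le_hi, inf_le_right⟩
    calc copulaLaw c (E.quantileMap γ ⁻¹' Iic x)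
        = copulaLaw c (Icc 0 fun j => E.margCDF j γ ((x ⊓ E.hi) j)) := measure_congr <| by
          filter_upwards [ae_copulaLaw_mem (c := c)] with u hu
          refine propext ⟨fun h => ⟨hu.1, fun j => ?_⟩, fun h j => ?_⟩
          · exact (quantile_le_iff hE (hreg j) hγ (hu.2 j) ⟨hx'.1 j, hx'.2 j⟩).1
              (le_inf (h j) (quantile_mem hE γ (u j)).2)
          · exact ((quantile_le_iff hE (hreg j) hγ (hu.2 j) ⟨hx'.1 j, hx'.2 j⟩).2
              (h.2 j)).trans inf_le_left
      _ = E.law γ (Icc E.lo (x ⊓ E.hi)) := hbox _ hx'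
      _ = E.law γ (Iic x) := measure_congr <| by
          filter_upwards [ae_law_mem_values (E := E) (γ := γ)] with θ hθ
          exact propext ⟨fun h => h.2.trans inf_le_left, fun h => ⟨hθ.1, le_inf h hθ.2⟩⟩
  · have h1 : E.quantileMap γ ⁻¹' Iic x = ∅ := by
      refine eq_empty_of_forall_notMem fun u hu => hx ?_
      exact (hE.quantileMap_mem γ u).1.trans hu
    have h2 : E.law γ (Iic x) = 0 := by
      refine measure_eq_zero_iff_ae_notMem.2 ?_
      filter_upwards [ae_law_mem_values (E := E) (γ := γ)] with θ hθ h
      exact hx (hθ.1.trans h)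
    rw [h1, h2, measure_empty]

theorem IsSmooth.isProbabilityMeasure_copulaLaw (hE : E.IsSmooth)
    (hreg : ∀ j, E.IsRegularMarginal j) {γ : ℝ}
    (hγ : γ ∈ E.types) {c : (Fin (n + 1) → ℝ) → ℝ} (hc : E.IsCopulaDensity γ c) :
    IsProbabilityMeasure (copulaLaw c) := by
  have := hE.isProbabilityMeasure_law hγ
  rw [← hE.map_quantileMap hreg hγ hc] at this
  exact Measure.isProbabilityMeasure_of_map (E.quantileMap γ)

theorem IsSmooth.condExp_eq_integral_copulaLaw (hE : E.IsSmooth)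
    (hreg : ∀ j, E.IsRegularMarginal j) {γ : ℝ} (hγ : γ ∈ E.types)
    {c : (Fin (n + 1) → ℝ) → ℝ} (hc : E.IsCopulaDensity γ c) {h : (Fin (n + 1) → ℝ) → ℝ}
    (hh : AEStronglyMeasurable h (E.law γ)) :
    E.condExp γ h = ∫ u, h (E.quantileMap γ u) ∂copulaLaw c := by
  rw [← hE.map_quantileMap hreg hγ hc] at hh
  rw [hE.condExp_eq_integral_law hγ, ← hE.map_quantileMap hreg hγ hc,
    integral_map (hE.measurable_quantileMap γ).aemeasurable hh]

end Transport

end Environment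

/-! ### Incentive compatible mechanisms and their separable combinations -/

/-- The payoff of a buyer of type `γ` with valuations `θ` who reports both truthfully. -/
noncomputable def Mechanism.payoff {n : ℕ} (M : Mechanism n) (γ : ℝ) (θ : Fin n → ℝ) : ℝ :=
  (∑ i, M.q γ θ i * θ i) - M.t1 γ - M.t2 γ θ

/-- The mechanism that never sells and never charges. -/
noncomputable def Mechanism.null (n : ℕ) : Mechanism n where
  q := fun _ _ _ => 0
  t1 := fun _ => 0
  t2 := fun _ _ => 0

/-- The mechanism that sells good `j` according to `M` and no other good. -/
noncomputable def Mechanism.only {n : ℕ} (j : Fin n) (M : Mechanism 1) : Mechanism n :=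
  Mechanism.separate (update (fun _ => Mechanism.null 1) j M)

namespace Environment

section Payoff

variable {n : ℕ} {E : Environment n} {M : Mechanism n}

theorem Feasible.measurable_payoff (hM : E.Feasible M) :
    Measurable fun p : ℝ × (Fin n → ℝ) => M.payoff p.1 p.2 := by
  refine ((Finset.measurable_sum _ fun i _ => ?_).sub (hM.t1_measurable.comp measurable_fst)).sub
    hM.t2_measurable
  exact ((measurable_pi_apply i).comp hM.q_measurable).mul
    ((measurable_pi_apply i).comp measurable_snd)

theorem Feasible.measurable_payoff_right (hM : E.Feasible M) (γ : ℝ) : Measurable (M.payoff γ) :=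
  hM.measurable_payoff.comp measurable_prodMk_left

theorem Feasible.measurable_q_right (hM : E.Feasible M) (γ : ℝ) (i : Fin n) :
    Measurable fun θ => M.q γ θ i :=
  (measurable_pi_apply i).comp (hM.q_measurable.comp measurable_prodMk_left)

theorem deviationPayoff_eq
    (hic : ∀ γ ∈ E.types, ∀ θ ∈ E.values, ∀ θ' ∈ E.values,
      (∑ i, M.q γ θ' i * θ i) - M.t2 γ θ' ≤ (∑ i, M.q γ θ i * θ i) - M.t2 γ θ)
    {γ γ' : ℝ} (hγ' : γ' ∈ E.types) :
    E.deviationPayoff M γ γ' = E.condExp γ (M.payoff γ') := by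
  refine setIntegral_congr_fun measurableSet_values fun θ hθ => ?_
  have : Nonempty E.values := ⟨⟨θ, hθ⟩⟩
  have hle : ∀ θ' : E.values,
      (∑ i, M.q γ' θ' i * θ i) - M.t1 γ' - M.t2 γ' θ' ≤ M.payoff γ' θ := fun θ' => by
    have := hic γ' hγ' θ hθ θ' θ'.2
    rw [Mechanism.payoff]
    linarith
  simp only
  congr 1
  exact le_antisymm (ciSup_le hle) (le_ciSup (f := fun θ' : E.values =>
    (∑ i, M.q γ' θ' i * θ i) - M.t1 γ' - M.t2 γ' θ')
    ⟨_, forall_mem_range.2 hle⟩ ⟨θ, hθ⟩)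

/-- The allocation is a subgradient of the payoff: this is (IC2). -/
theorem Feasible.payoff_add_le (hM : E.Feasible M) {γ : ℝ} (hγ : γ ∈ E.types)
    {θ θ' : Fin n → ℝ} (hθ : θ ∈ E.values) (hθ' : θ' ∈ E.values) :
    M.payoff γ θ' + ∑ i, M.q γ θ' i * (θ i - θ' i) ≤ M.payoff γ θ := by
  have h := hM.ic2 γ hγ θ hθ θ' hθ'
  simp only [Mechanism.payoff, mul_sub, Finset.sum_sub_distrib]
  linarith

theorem abs_sum_mul_le {q x y : Fin n → ℝ} (hq : ∀ i, q i ∈ Icc (0 : ℝ) 1)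
    (hxy : ∀ i, |x i| ≤ y i) : |∑ i, q i * x i| ≤ ∑ i, y i := by
  refine (Finset.abs_sum_le_sum_abs _ _).trans (Finset.sum_le_sum fun i _ => ?_)
  rw [abs_mul, abs_of_nonneg (hq i).1]
  exact (mul_le_of_le_one_left (abs_nonneg _) (hq i).2).trans (hxy i)

theorem Feasible.abs_payoff_sub_le (hM : E.Feasible M) {γ : ℝ} (hγ : γ ∈ E.types)
    {θ θ' : Fin n → ℝ} (hθ : θ ∈ E.values) (hθ' : θ' ∈ E.values) :
    |M.payoff γ θ - M.payoff γ θ'| ≤ ∑ i, (E.hi i - E.lo i) := by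
  have hd : ∀ i, |θ i - θ' i| ≤ E.hi i - E.lo i := fun i =>
    abs_sub_le_of_le_of_le (hθ.1 i) (hθ.2 i) (hθ'.1 i) (hθ'.2 i)
  have hd' : ∀ i, |θ' i - θ i| ≤ E.hi i - E.lo i := fun i => abs_sub_comm (θ i) _ ▸ hd i
  have h1 := hM.payoff_add_le hγ hθ hθ'
  have h2 := hM.payoff_add_le hγ hθ' hθ
  have h3 := abs_le.1 (abs_sum_mul_le (hM.q_mem γ hγ θ' hθ') hd)
  have h4 := abs_le.1 (abs_sum_mul_le (hM.q_mem γ hγ θ hθ) hd')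
  rw [abs_le]
  constructor <;> linarith [h3.1, h4.1]

theorem Feasible.exists_payoff_bound (hM : E.Feasible M) {γ : ℝ} (hγ : γ ∈ E.types) :
    ∃ C, ∀ θ ∈ E.values, |M.payoff γ θ| ≤ C := by
  by_cases h : E.values.Nonempty
  · obtain ⟨θ₀, hθ₀⟩ := h
    refine ⟨|M.payoff γ θ₀| + ∑ i, (E.hi i - E.lo i), fun θ hθ => ?_⟩
    have h1 := hM.abs_payoff_sub_le hγ hθ hθ₀
    have h2 := abs_add_le (M.payoff γ θ₀) (M.payoff γ θ - M.payoff γ θ₀)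
    rw [add_sub_cancel] at h2
    linarith
  · exact ⟨0, fun θ hθ => (h ⟨θ, hθ⟩).elim⟩

theorem abs_coord_le {θ : Fin n → ℝ} (hθ : θ ∈ E.values) (i : Fin n) :
    |θ i| ≤ |E.lo i| + |E.hi i| := by
  rw [abs_le]
  constructor
  · linarith [hθ.1 i, neg_abs_le (E.lo i), abs_nonneg (E.hi i)]
  · linarith [hθ.2 i, le_abs_self (E.hi i), abs_nonneg (E.lo i)]

theorem Feasible.abs_sum_q_mul_le (hM : E.Feasible M) {γ : ℝ} (hγ : γ ∈ E.types)
    {θ : Fin n → ℝ} (hθ : θ ∈ E.values) :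
    |∑ i, M.q γ θ i * θ i| ≤ ∑ i, (|E.lo i| + |E.hi i|) :=
  abs_sum_mul_le (hM.q_mem γ hγ θ hθ) fun i => abs_coord_le hθ i

theorem t1_add_t2_eq (M : Mechanism n) (γ : ℝ) (θ : Fin n → ℝ) :
    M.t1 γ + M.t2 γ θ = (∑ i, M.q γ θ i * θ i) - M.payoff γ θ := by
  rw [Mechanism.payoff]; ring

theorem Feasible.exists_transfer_bound (hM : E.Feasible M) {γ : ℝ} (hγ : γ ∈ E.types) :
    ∃ C, ∀ θ ∈ E.values, |M.t1 γ + M.t2 γ θ| ≤ C := by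
  obtain ⟨C, hC⟩ := hM.exists_payoff_bound hγ
  refine ⟨(∑ i, (|E.lo i| + |E.hi i|)) + C, fun θ hθ => ?_⟩
  rw [t1_add_t2_eq]
  exact (abs_sub _ _).trans (add_le_add (hM.abs_sum_q_mul_le hγ hθ) (hC θ hθ))

theorem IsSmooth.integrable_law_of_bound (hE : E.IsSmooth) {γ : ℝ} (hγ : γ ∈ E.types)
    {h : (Fin n → ℝ) → ℝ} (hh : AEStronglyMeasurable h (E.law γ)) {C : ℝ}
    (hC : ∀ θ ∈ E.values, |h θ| ≤ C) : Integrable h (E.law γ) := by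
  have := hE.isProbabilityMeasure_law hγ
  refine Integrable.of_bound hh C ?_
  filter_upwards [ae_law_mem_values] with θ hθ
  exact hC θ hθ

theorem Feasible.integrable_payoff (hM : E.Feasible M) (hE : E.IsSmooth) {γ γ' : ℝ}
    (hγ : γ ∈ E.types) (hγ' : γ' ∈ E.types) : Integrable (M.payoff γ') (E.law γ) := by
  obtain ⟨C, hC⟩ := hM.exists_payoff_bound hγ'
  exact hE.integrable_law_of_bound hγ
    (hM.measurable_payoff_right γ').aestronglyMeasurable hC

theorem feasible_null : E.Feasible (Mechanism.null n) where
  q_measurable := measurable_const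
  t1_measurable := measurable_const
  t2_measurable := measurable_const
  q_mem := fun _ _ _ _ _ => ⟨le_rfl, zero_le_one⟩
  ic1 := fun γ hγ γ' hγ' => by
    rw [deviationPayoff_eq (fun _ _ _ _ _ _ => by simp [Mechanism.null]) hγ',
      deviationPayoff_eq (fun _ _ _ _ _ _ => by simp [Mechanism.null]) hγ]
    rfl
  ic2 := fun _ _ _ _ _ _ => by simp [Mechanism.null]
  ir := fun γ _ => by simp [Mechanism.null, condExp]

end Payoff

section Separate

variable {n : ℕ} {E : Environment (n + 1)}

theorem const_mem_oneGood_values {θ : Fin (n + 1) → ℝ} (hθ : θ ∈ E.values) (j : Fin (n + 1)) :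
    (fun _ => θ j) ∈ (E.oneGood j).values :=
  ⟨fun _ => hθ.1 j, fun _ => hθ.2 j⟩

theorem condExp_oneGood_eq_integral (j : Fin (n + 1)) (γ : ℝ) (k : (Fin 1 → ℝ) → ℝ) :
    (E.oneGood j).condExp γ k =
      ∫ x in Icc (E.lo j) (E.hi j), k (fun _ => x) * E.margDensity j γ x := by
  have hmp := volume_preserving_funUnique (Fin 1) ℝ
  rw [← hmp.setIntegral_preimage_emb (MeasurableEquiv.measurableEmbedding _)]
  have hpre : (MeasurableEquiv.funUnique (Fin 1) ℝ) ⁻¹' Icc (E.lo j) (E.hi j) =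
      (E.oneGood j).values := by
    ext θ
    simp [values, oneGood, Pi.le_def, MeasurableEquiv.funUnique]
  rw [hpre, condExp]
  refine setIntegral_congr_fun measurableSet_values fun θ _ => ?_
  have h1 : (fun _ => (MeasurableEquiv.funUnique (Fin 1) ℝ) θ) = θ :=
    funext fun i => by rw [Subsingleton.elim i 0]; rfl
  simp only [h1]
  rfl

/-- Expectations in the one-good problem are expectations of functions of one coordinate. -/
theorem IsSmooth.condExp_oneGood (hE : E.IsSmooth) (j : Fin (n + 1)) {γ : ℝ} (hγ : γ ∈ E.types)
    {k : (Fin 1 → ℝ) → ℝ} (hk : Integrable (fun θ => k (fun _ => θ j)) (E.law γ)) :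
    (E.oneGood j).condExp γ k = E.condExp γ fun θ => k (fun _ => θ j) := by
  rw [condExp_oneGood_eq_integral,
    condExp_coord_eq j (k := fun x => k fun _ => x) ((hE.integrable_law_iff hγ).1 hk)]

theorem measurable_prodMk_const_apply (j : Fin (n + 1)) :
    Measurable fun p : ℝ × (Fin (n + 1) → ℝ) => (p.1, fun _ : Fin 1 => p.2 j) :=
  measurable_fst.prodMk (measurable_pi_iff.2 fun _ =>
    (measurable_pi_apply j).comp measurable_snd)

theorem IsSmooth.integrable_oneGood_of_bound (hE : E.IsSmooth) {j : Fin (n + 1)} {γ : ℝ}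
    (hγ : γ ∈ E.types) {k : (Fin 1 → ℝ) → ℝ} (hk : Measurable k) {C : ℝ}
    (hC : ∀ θ ∈ (E.oneGood j).values, |k θ| ≤ C) :
    Integrable (fun θ => k (fun _ => θ j)) (E.law γ) := by
  refine hE.integrable_law_of_bound hγ (Measurable.aestronglyMeasurable ?_)
    fun θ hθ => hC _ (const_mem_oneGood_values hθ j)
  exact hk.comp (measurable_pi_iff.2 fun _ => measurable_pi_apply j)

theorem payoff_separate (M : Fin (n + 1) → Mechanism 1) (γ : ℝ) (θ : Fin (n + 1) → ℝ) :
    (Mechanism.separate M).payoff γ θ = ∑ j, (M j).payoff γ fun _ => θ j := by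
  simp [Mechanism.payoff, Mechanism.separate, Finset.sum_sub_distrib]

theorem Feasible.integrable_payoff_oneGood {M : Mechanism 1} {j : Fin (n + 1)}
    (hM : (E.oneGood j).Feasible M) (hE : E.IsSmooth) {γ γ' : ℝ} (hγ : γ ∈ E.types)
    (hγ' : γ' ∈ E.types) : Integrable (fun θ => M.payoff γ' fun _ => θ j) (E.law γ) := by
  obtain ⟨C, hC⟩ := hM.exists_payoff_bound (γ := γ') hγ'
  exact hE.integrable_oneGood_of_bound hγ (hM.measurable_payoff_right γ') hC

theorem condExp_payoff_separate (hE : E.IsSmooth) {M : Fin (n + 1) → Mechanism 1}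
    (hM : ∀ j, (E.oneGood j).Feasible (M j)) {γ γ' : ℝ} (hγ : γ ∈ E.types)
    (hγ' : γ' ∈ E.types) : E.condExp γ ((Mechanism.separate M).payoff γ') =
      ∑ j, (E.oneGood j).condExp γ ((M j).payoff γ') := by
  rw [hE.condExp_eq_integral_law hγ]
  simp only [payoff_separate]
  rw [integral_finsetSum _ fun j _ => (hM j).integrable_payoff_oneGood hE hγ hγ']
  refine Finset.sum_congr rfl fun j _ => ?_
  rw [hE.condExp_oneGood j hγ ((hM j).integrable_payoff_oneGood hE hγ hγ'),
    hE.condExp_eq_integral_law hγ]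

/-- Feasibility is preserved when one-good mechanisms are offered side by side. -/
theorem feasible_separate (hE : E.IsSmooth) {M : Fin (n + 1) → Mechanism 1}
    (hM : ∀ j, (E.oneGood j).Feasible (M j)) : E.Feasible (Mechanism.separate M) := by
  have hic2 : ∀ γ ∈ E.types, ∀ θ ∈ E.values, ∀ θ' ∈ E.values,
      (∑ i, (Mechanism.separate M).q γ θ' i * θ i) - (Mechanism.separate M).t2 γ θ' ≤
        (∑ i, (Mechanism.separate M).q γ θ i * θ i) - (Mechanism.separate M).t2 γ θ := by
    intro γ hγ θ hθ θ' hθ'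
    simp only [Mechanism.separate, ← Finset.sum_sub_distrib]
    refine Finset.sum_le_sum fun j _ => ?_
    simpa using (hM j).ic2 γ hγ _ (const_mem_oneGood_values hθ j) _
      (const_mem_oneGood_values hθ' j)
  refine ⟨?_, ?_, ?_, ?_, ?_, hic2, ?_⟩
  · refine measurable_pi_iff.2 fun j => ?_
    exact (measurable_pi_apply 0).comp
      ((hM j).q_measurable.comp (measurable_prodMk_const_apply j))
  · simp only [Mechanism.separate]
    exact Finset.measurable_sum _ fun j _ => (hM j).t1_measurable
  · simp only [Mechanism.separate]
    exact Finset.measurable_sum _ fun j _ =>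
      (hM j).t2_measurable.comp (measurable_prodMk_const_apply j)
  · exact fun γ hγ θ hθ j => (hM j).q_mem γ hγ _ (const_mem_oneGood_values hθ j) 0
  · intro γ hγ γ' hγ'
    rw [deviationPayoff_eq hic2 hγ', deviationPayoff_eq hic2 hγ,
      condExp_payoff_separate hE hM hγ hγ', condExp_payoff_separate hE hM hγ hγ]
    refine Finset.sum_le_sum fun j _ => ?_
    have h := (hM j).ic1 γ hγ γ' hγ'
    rwa [deviationPayoff_eq (hM j).ic2 hγ', deviationPayoff_eq (hM j).ic2 hγ] at h
  · intro γ hγ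
    change 0 ≤ E.condExp γ ((Mechanism.separate M).payoff γ)
    rw [condExp_payoff_separate hE hM hγ hγ]
    exact Finset.sum_nonneg fun j _ => (hM j).ir γ hγ

theorem feasible_only (hE : E.IsSmooth) {j : Fin (n + 1)} {M : Mechanism 1}
    (hM : (E.oneGood j).Feasible M) : E.Feasible (Mechanism.only j M) := by
  refine feasible_separate hE fun i => ?_
  by_cases h : i = j
  · subst h
    rwa [update_self]
  · rw [update_of_ne h]
    exact feasible_null

theorem only_q_self (j : Fin (n + 1)) (M : Mechanism 1) (γ : ℝ) (θ : Fin (n + 1) → ℝ) :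
    (Mechanism.only j M).q γ θ j = M.q γ (fun _ => θ j) 0 := by
  simp [Mechanism.only, Mechanism.separate]

theorem only_q_of_ne {i j : Fin (n + 1)} (h : i ≠ j) (M : Mechanism 1) (γ : ℝ)
    (θ : Fin (n + 1) → ℝ) : (Mechanism.only j M).q γ θ i = 0 := by
  simp [Mechanism.only, Mechanism.separate, h, Mechanism.null]

theorem only_t1 (j : Fin (n + 1)) (M : Mechanism 1) (γ : ℝ) :
    (Mechanism.only j M).t1 γ = M.t1 γ := by
  simp only [Mechanism.only, Mechanism.separate]
  rw [Finset.sum_eq_single j (fun i _ hi => by simp [hi, Mechanism.null]) (by simp)]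
  simp

theorem only_t2 (j : Fin (n + 1)) (M : Mechanism 1) (γ : ℝ) (θ : Fin (n + 1) → ℝ) :
    (Mechanism.only j M).t2 γ θ = M.t2 γ fun _ => θ j := by
  simp only [Mechanism.only, Mechanism.separate]
  rw [Finset.sum_eq_single j (fun i _ hi => by simp [hi, Mechanism.null]) (by simp)]
  simp

theorem only_payoff (j : Fin (n + 1)) (M : Mechanism 1) (γ : ℝ) (θ : Fin (n + 1) → ℝ) :
    (Mechanism.only j M).payoff γ θ = M.payoff γ fun _ => θ j := by
  rw [Mechanism.payoff, only_t1, only_t2,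
    Finset.sum_eq_single j (fun i _ hi => by simp [only_q_of_ne hi]) (by simp), only_q_self]
  simp [Mechanism.payoff]

theorem condExp_payoff_only (hE : E.IsSmooth) {j : Fin (n + 1)} {M : Mechanism 1}
    (hM : (E.oneGood j).Feasible M) {γ : ℝ} (hγ : γ ∈ E.types) :
    E.condExp γ ((Mechanism.only j M).payoff γ) = (E.oneGood j).condExp γ (M.payoff γ) := by
  rw [hE.condExp_oneGood j hγ (hM.integrable_payoff_oneGood hE hγ hγ)]
  simp only [condExp, only_payoff]

theorem revenue_only (hE : E.IsSmooth) {j : Fin (n + 1)} {M : Mechanism 1}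
    (hM : (E.oneGood j).Feasible M) :
    E.revenue (Mechanism.only j M) = (E.oneGood j).revenue M := by
  refine setIntegral_congr_fun measurableSet_Icc fun γ hγ => ?_
  obtain ⟨C, hC⟩ := hM.exists_transfer_bound (γ := γ) hγ
  have hm : Measurable fun θ => M.t1 γ + M.t2 γ θ :=
    measurable_const.add (hM.t2_measurable.comp measurable_prodMk_left)
  have h := hE.condExp_oneGood j hγ (hE.integrable_oneGood_of_bound hγ hm hC)
  simp only [only_t1, only_t2, h]
  rfl

end Separate

end Environment

/-! ### The envelope formula -/

namespace Environment

/-- The equilibrium payoff of type `γ`. -/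
noncomputable def rent {n : ℕ} (E : Environment n) (M : Mechanism n) (γ : ℝ) : ℝ :=
  E.condExp γ (M.payoff γ)

section Envelope

variable {n : ℕ} {E : Environment (n + 1)} {M : Mechanism (n + 1)}
  {c : (Fin (n + 1) → ℝ) → ℝ}

theorem velocity_continuousOn (hE : E.IsSmooth) {j : Fin (n + 1)} (hreg : E.IsRegularMarginal j) :
    ContinuousOn (uncurry (E.velocity j)) (E.types ×ˢ Icc (E.lo j) (E.hi j)) :=
  ((hE.margCDFDeriv_continuousOn j).div (hE.margDensity_continuousOn j)
    fun p hp => (hreg.density_pos p.1 hp.1 p.2 hp.2).ne').neg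

theorem exists_velocity_bound (hE : E.IsSmooth) {j : Fin (n + 1)}
    (hreg : E.IsRegularMarginal j) :
    ∃ C, ∀ γ ∈ E.types, ∀ x ∈ Icc (E.lo j) (E.hi j), |E.velocity j γ x| ≤ C := by
  have hc : IsCompact (E.types ×ˢ Icc (E.lo j) (E.hi j)) := isCompact_Icc.prod isCompact_Icc
  obtain ⟨C, hC⟩ := hc.exists_bound_of_continuousOn (velocity_continuousOn hE hreg)
  exact ⟨C, fun γ hγ x hx => hC (γ, x) (mk_mem_prod hγ hx)⟩

theorem coord_mem {θ : Fin (n + 1) → ℝ} (hθ : θ ∈ E.values) (j : Fin (n + 1)) :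
    θ j ∈ Icc (E.lo j) (E.hi j) :=
  ⟨hθ.1 j, hθ.2 j⟩

theorem aestronglyMeasurable_law_of_continuousOn {γ : ℝ} {h : (Fin (n + 1) → ℝ) → ℝ}
    (hh : ContinuousOn h E.values) : AEStronglyMeasurable h (E.law γ) :=
  (hh.aestronglyMeasurable measurableSet_values).mono_ac (withDensity_absolutelyContinuous _ _)

theorem aestronglyMeasurable_velocity (hE : E.IsSmooth) {j : Fin (n + 1)}
    (hreg : E.IsRegularMarginal j) {γ : ℝ} (hγ : γ ∈ E.types) :
    AEStronglyMeasurable (fun θ : Fin (n + 1) → ℝ => E.velocity j γ (θ j)) (E.law γ) :=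
  aestronglyMeasurable_law_of_continuousOn
    ((velocity_continuousOn hE hreg).comp (f := fun θ : Fin (n + 1) → ℝ => (γ, θ j))
      (by fun_prop) fun _ hθ => ⟨hγ, coord_mem hθ j⟩)

theorem Feasible.aestronglyMeasurable_q_mul_velocity (hM : E.Feasible M) (hE : E.IsSmooth)
    (hreg : ∀ j, E.IsRegularMarginal j) {γ : ℝ} (hγ : γ ∈ E.types) :
    AEStronglyMeasurable (fun θ : Fin (n + 1) → ℝ => ∑ i, M.q γ θ i * E.velocity i γ (θ i))
      (E.law γ) :=
  Finset.aestronglyMeasurable_fun_sum _ fun i _ =>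
    (hM.measurable_q_right γ i).aestronglyMeasurable.mul
      (aestronglyMeasurable_velocity hE (hreg i) hγ)

/-- The effect on the payoff in the mechanism intended for `γ'` of transporting the valuations
of `γ'` to those of `γ`, to first order in the valuations. -/
noncomputable def transportGain (E : Environment (n + 1)) (M : Mechanism (n + 1)) (γ' γ : ℝ)
    (u : Fin (n + 1) → ℝ) : ℝ :=
  ∑ i, M.q γ' (E.quantileMap γ' u) i * (E.quantileMap γ u i - E.quantileMap γ' u i)

theorem Feasible.measurable_transportGain (hM : E.Feasible M) (hE : E.IsSmooth) (γ' γ : ℝ) :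
    Measurable (E.transportGain M γ' γ) := by
  refine Finset.measurable_sum _ fun i _ => ?_
  exact ((hM.measurable_q_right γ' i).comp (hE.measurable_quantileMap γ')).mul
    (((measurable_pi_apply i).comp (hE.measurable_quantileMap γ)).sub
      ((measurable_pi_apply i).comp (hE.measurable_quantileMap γ')))

/-- The gain is Lipschitz in the imitating type, uniformly in the mechanism, the imitated type and
the point of the cube. -/
theorem exists_transportGain_lipschitz (hE : E.IsSmooth) (hreg : ∀ j, E.IsRegularMarginal j) :
    ∃ K : ℝ, 0 ≤ K ∧ ∀ M, E.Feasible M → ∀ γ' ∈ E.types, ∀ s ∈ E.types, ∀ t ∈ E.types,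
      ∀ u ∈ Icc (0 : Fin (n + 1) → ℝ) 1,
        |E.transportGain M γ' s u - E.transportGain M γ' t u| ≤ K * |s - t| := by
  choose K hK hlip using fun j => exists_quantile_lipschitz hE (hreg j)
  refine ⟨∑ j, K j, Finset.sum_nonneg fun j _ => hK j, fun M hM γ' hγ' s hs t ht u hu => ?_⟩
  have h : E.transportGain M γ' s u - E.transportGain M γ' t u =
      ∑ i, M.q γ' (E.quantileMap γ' u) i * (E.quantileMap s u i - E.quantileMap t u i) := by
    simp only [transportGain, ← Finset.sum_sub_distrib]
    exact Finset.sum_congr rfl fun i _ => by ring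
  rw [h, Finset.sum_mul]
  exact abs_sum_mul_le (hM.q_mem γ' hγ' _ (hE.quantileMap_mem γ' u))
    fun i => hlip i s hs t ht (u i) ⟨hu.1 i, hu.2 i⟩

theorem transportGain_self (γ : ℝ) (u : Fin (n + 1) → ℝ) : E.transportGain M γ γ u = 0 := by
  simp [transportGain]

theorem Feasible.integrable_transportGain (hM : E.Feasible M) (hE : E.IsSmooth)
    (hreg : ∀ j, E.IsRegularMarginal j) (hc : ∀ γ ∈ E.types, E.IsCopulaDensity γ c)
    {γ' γ : ℝ} (hγ' : γ' ∈ E.types) (hγ : γ ∈ E.types) :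
    Integrable (E.transportGain M γ' γ) (copulaLaw c) := by
  have := hE.isProbabilityMeasure_copulaLaw hreg hγ (hc γ hγ)
  obtain ⟨K, -, hK⟩ := exists_transportGain_lipschitz hE hreg
  refine Integrable.of_bound (hM.measurable_transportGain hE γ' γ).aestronglyMeasurable
    (K * |γ - γ'|) ?_
  filter_upwards [ae_copulaLaw_mem] with u hu
  simpa [transportGain_self] using hK M hM γ' hγ' γ hγ γ' hγ' u hu

/-- A type `γ` can pretend to be `γ'`; since its valuations are a transport of those of `γ'`
along a fixed copula, (IC1) and (IC2) bound the difference of the rents from below. -/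
theorem Feasible.rent_add_le (hM : E.Feasible M) (hE : E.IsSmooth)
    (hreg : ∀ j, E.IsRegularMarginal j) (hc : ∀ γ ∈ E.types, E.IsCopulaDensity γ c)
    {γ' γ : ℝ} (hγ' : γ' ∈ E.types) (hγ : γ ∈ E.types) :
    E.rent M γ' + ∫ u, E.transportGain M γ' γ u ∂copulaLaw c ≤ E.rent M γ := by
  have hic := hM.ic1 γ hγ γ' hγ'
  have hint : ∀ s ∈ E.types,
      Integrable (fun u => M.payoff γ' (E.quantileMap s u)) (copulaLaw c) := fun s hs => by
    have h := hM.integrable_payoff hE hs hγ'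
    rw [← hE.map_quantileMap hreg hs (hc s hs)] at h
    exact h.comp_measurable (hE.measurable_quantileMap s)
  rw [deviationPayoff_eq hM.ic2 hγ', deviationPayoff_eq hM.ic2 hγ] at hic
  refine le_trans ?_ hic
  rw [rent, hE.condExp_eq_integral_copulaLaw hreg hγ' (hc γ' hγ')
      (hM.measurable_payoff_right γ').aestronglyMeasurable,
    hE.condExp_eq_integral_copulaLaw hreg hγ (hc γ hγ)
      (hM.measurable_payoff_right γ').aestronglyMeasurable,
    ← integral_add (hint γ' hγ') (hM.integrable_transportGain hE hreg hc hγ' hγ)]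
  exact integral_mono ((hint γ' hγ').add (hM.integrable_transportGain hE hreg hc hγ' hγ))
    (hint γ hγ) fun u => hM.payoff_add_le hγ' (hE.quantileMap_mem γ u) (hE.quantileMap_mem γ' u)

theorem Feasible.exists_rent_lipschitz (hM : E.Feasible M) (hE : E.IsSmooth)
    (hreg : ∀ j, E.IsRegularMarginal j) (hc : ∀ γ ∈ E.types, E.IsCopulaDensity γ c) :
    ∃ K : NNReal, LipschitzOnWith K (E.rent M) E.types := by
  obtain ⟨K, hK0, hK⟩ := exists_transportGain_lipschitz hE hreg
  have key : ∀ s ∈ E.types, ∀ t ∈ E.types, E.rent M s - E.rent M t ≤ K * |s - t| := by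
    intro s hs t ht
    have := hE.isProbabilityMeasure_copulaLaw hreg hs (hc s hs)
    have h1 := hM.rent_add_le hE hreg hc hs ht
    have h2 : ‖∫ u, E.transportGain M s t u ∂copulaLaw c‖ ≤ K * |t - s| := by
      refine (norm_integral_le_of_norm_le_const (C := K * |t - s|) ?_).trans_eq (by simp)
      filter_upwards [ae_copulaLaw_mem] with u hu
      simpa [transportGain_self] using hK M hM s hs t ht s hs u hu
    rw [abs_sub_comm s t]
    linarith [(abs_le.1 h2).1]
  refine ⟨⟨K, hK0⟩, LipschitzOnWith.of_dist_le_mul fun s hs t ht => ?_⟩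
  rw [Real.dist_eq, Real.dist_eq, abs_le]
  have h1 := key s hs t ht
  have h2 := key t ht s hs
  rw [abs_sub_comm] at h2
  change -(K * |s - t|) ≤ _ ∧ _ ≤ K * |s - t|
  constructor <;> linarith

/-- The envelope formula: where the rent is differentiable, its derivative is the expected
velocity of the valuations of the goods that are sold. The transport bound touches the rent
from below, so both have the same derivative. -/
theorem Feasible.deriv_rent_eq (hM : E.Feasible M) (hE : E.IsSmooth)
    (hreg : ∀ j, E.IsRegularMarginal j) (hc : ∀ γ ∈ E.types, E.IsCopulaDensity γ c)
    {γ : ℝ} (hγ : γ ∈ Ioo E.a E.b) (hd : DifferentiableAt ℝ (E.rent M) γ) :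
    deriv (E.rent M) γ =
      E.condExp γ fun θ => ∑ i, M.q γ θ i * E.velocity i γ (θ i) := by
  have hγt : γ ∈ E.types := Ioo_subset_Icc_self hγ
  have hnhds : E.types ∈ 𝓝 γ := Icc_mem_nhds hγ.1 hγ.2
  have hprob := hE.isProbabilityMeasure_copulaLaw hreg hγt (hc γ hγt)
  have hmeas := hM.aestronglyMeasurable_q_mul_velocity hE hreg hγt
  obtain ⟨K, hK0, hK⟩ := exists_transportGain_lipschitz hE hreg
  have hder := (hasDerivAt_integral_of_dominated_loc_of_lip (μ := copulaLaw c)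
    (F := fun s u => E.transportGain M γ s u) (x₀ := γ) (s := E.types)
    (F' := fun u => ∑ i, M.q γ (E.quantileMap γ u) i *
      E.velocity i γ (E.quantileMap γ u i)) (bound := fun _ => K) hnhds
    (Eventually.of_forall fun s => (hM.measurable_transportGain hE γ s).aestronglyMeasurable)
    (hM.integrable_transportGain hE hreg hc hγt hγt) ?_ ?_ (integrable_const _) ?_).2
  · have h1 : IsLocalMin (fun s => E.rent M s - ∫ u, E.transportGain M γ s u ∂copulaLaw c) γ := by
      filter_upwards [hnhds] with s hs
      have := hM.rent_add_le hE hreg hc hγt hs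
      simp only [transportGain_self, integral_zero]
      linarith
    have h2 := h1.hasDerivAt_eq_zero (hd.hasDerivAt.sub hder)
    rw [hE.condExp_eq_integral_copulaLaw hreg hγt (hc γ hγt) hmeas]
    linarith
  · rw [← hE.map_quantileMap hreg hγt (hc γ hγt)] at hmeas
    exact hmeas.comp_measurable (hE.measurable_quantileMap γ)
  · filter_upwards [ae_copulaLaw_mem] with u hu
    refine LipschitzOnWith.of_dist_le_mul fun s hs t ht => ?_
    rw [Real.dist_eq, Real.dist_eq, Real.coe_nnabs, abs_of_nonneg hK0]
    exact hK M hM γ hγt s hs t ht u hu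
  · filter_upwards [ae_copulaLaw_mem] with u hu
    refine HasDerivAt.fun_sum fun i _ => HasDerivAt.const_mul _ (HasDerivAt.sub_const _ ?_)
    exact (hasDerivWithinAt_quantile hE (hreg i) hγt ⟨hu.1 i, hu.2 i⟩).hasDerivAt hnhds

end Envelope

end Environment

/-! ### Revenue as expected virtual surplus -/

namespace Environment

section Joint

variable {n : ℕ} {E : Environment n}

/-- Lebesgue measure on the product of the type interval and the box of valuations. -/
noncomputable def joint (E : Environment n) : Measure (ℝ × (Fin n → ℝ)) :=
  (volume.restrict E.types).prod (volume.restrict E.values)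

theorem joint_eq (E : Environment n) :
    E.joint = volume.restrict (E.types ×ˢ E.values) := by
  rw [joint, Measure.prod_restrict, Measure.volume_eq_prod]

theorem measurableSet_types_prod_values (E : Environment n) :
    MeasurableSet (E.types ×ˢ E.values) :=
  measurableSet_Icc.prod measurableSet_Icc

theorem ae_joint_mem (E : Environment n) : ∀ᵐ p ∂E.joint, p ∈ E.types ×ˢ E.values := by
  rw [joint_eq]
  exact ae_restrict_mem E.measurableSet_types_prod_values

theorem aestronglyMeasurable_joint_of_continuousOn {k : ℝ × (Fin n → ℝ) → ℝ}
    (hk : ContinuousOn k (E.types ×ˢ E.values)) : AEStronglyMeasurable k E.joint := by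
  rw [joint_eq]
  exact hk.aestronglyMeasurable E.measurableSet_types_prod_values

theorem IsSmooth.integrable_joint (hE : E.IsSmooth) {k : ℝ × (Fin n → ℝ) → ℝ} {C : ℝ}
    (hk : AEStronglyMeasurable k E.joint) (hC : ∀ p ∈ E.types ×ˢ E.values, |k p| ≤ C)
    {w : ℝ → ℝ} (hw : IntegrableOn w E.types) :
    Integrable (fun p => k p * E.f p.1 p.2 * w p.1) E.joint := by
  have hfin : IsFiniteMeasure (volume.restrict E.values) :=
    ⟨by rw [Measure.restrict_apply_univ]; exact isCompact_Icc.measure_lt_top⟩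
  have hfc := hE.f_contDiff.continuousOn
  have hcomp : IsCompact (E.types ×ˢ E.values) := isCompact_Icc.prod isCompact_Icc
  obtain ⟨D, hD⟩ := hcomp.exists_bound_of_continuousOn hfc
  refine (Integrable.comp_fst hw (volume.restrict E.values)).bdd_mul (c := C * D)
    (hk.mul (aestronglyMeasurable_joint_of_continuousOn hfc)) ?_
  filter_upwards [E.ae_joint_mem] with p hp
  rw [norm_mul]
  exact mul_le_mul (hC p hp) (hD p hp) (norm_nonneg _) ((abs_nonneg _).trans (hC p hp))

theorem IsSmooth.integral_joint (hE : E.IsSmooth) {k : ℝ × (Fin n → ℝ) → ℝ} {C : ℝ}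
    (hk : AEStronglyMeasurable k E.joint) (hC : ∀ p ∈ E.types ×ˢ E.values, |k p| ≤ C)
    {w : ℝ → ℝ} (hw : IntegrableOn w E.types) :
    IntegrableOn (fun γ => E.condExp γ (fun θ => k (γ, θ)) * w γ) E.types ∧
    ∫ p, k p * E.f p.1 p.2 * w p.1 ∂E.joint =
      ∫ γ in E.types, E.condExp γ (fun θ => k (γ, θ)) * w γ := by
  have h := hE.integrable_joint hk hC hw
  have h1 := h.integral_prod_left
  have h2 := integral_prod _ h
  simp only [integral_mul_const] at h1 h2
  exact ⟨h1, h2⟩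

end Joint

section Distribution

variable {n : ℕ} {E : Environment n}

theorem IsSmooth.g_intervalIntegrable (hE : E.IsSmooth) :
    IntervalIntegrable E.g volume E.a E.b :=
  (intervalIntegrable_iff_integrableOn_Icc_of_le hE.a_lt_b.le).2 hE.g_integrable

theorem G_a : E.G E.a = 0 := by simp [G]

theorem IsSmooth.G_b (hE : E.IsSmooth) : E.G E.b = 1 := by
  rw [G, intervalIntegral.integral_of_le hE.a_lt_b.le, ← integral_Icc_eq_integral_Ioc]
  exact hE.g_integral

theorem IsSmooth.G_absolutelyContinuous (hE : E.IsSmooth) :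
    AbsolutelyContinuousOnInterval E.G E.a E.b :=
  hE.g_intervalIntegrable.absolutelyContinuousOnInterval_intervalIntegral (by simp)

theorem IsSmooth.one_sub_G_integrableOn (hE : E.IsSmooth) :
    IntegrableOn (fun γ => 1 - E.G γ) E.types := by
  have h := hE.G_absolutelyContinuous.continuousOn
  rw [uIcc_of_le hE.a_lt_b.le] at h
  exact (continuousOn_const.sub h).integrableOn_compact isCompact_Icc

/-- Integration by parts against the distribution of types. -/
theorem IsSmooth.integral_mul_g (hE : E.IsSmooth) {U h : ℝ → ℝ} {K : NNReal}
    (hU : LipschitzOnWith K U E.types)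
    (hd : ∀ γ ∈ Ioo E.a E.b, DifferentiableAt ℝ U γ → deriv U γ = h γ) :
    ∫ γ in E.types, U γ * E.g γ = U E.a + ∫ γ in E.types, h γ * (1 - E.G γ) := by
  have hab := hE.a_lt_b.le
  have hUac : AbsolutelyContinuousOnInterval U E.a E.b := by
    refine LipschitzOnWith.absolutelyContinuousOnInterval (K := K) ?_
    rwa [uIcc_of_le hab]
  have hGac := hE.G_absolutelyContinuous
  have hset : ∀ F : ℝ → ℝ, ∫ γ in E.types, F γ = ∫ γ in E.a..E.b, F γ := fun F => by
    rw [intervalIntegral.integral_of_le hab, ← integral_Icc_eq_integral_Ioc]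
    rfl
  have h1 : ∫ γ in E.a..E.b, U γ * E.g γ = ∫ γ in E.a..E.b, U γ * deriv E.G γ := by
    refine intervalIntegral.integral_congr_ae ?_
    filter_upwards [hE.g_intervalIntegrable.ae_hasDerivAt_integral] with γ hγ hmem
    have hG : HasDerivAt E.G (E.g γ) γ := hγ (uIoc_subset_uIcc hmem) E.a (by simp)
    rw [hG.deriv]
  have h2 : ∫ γ in E.a..E.b, h γ * (1 - E.G γ) = ∫ γ in E.a..E.b, deriv U γ * (1 - E.G γ) := by
    refine intervalIntegral.integral_congr_ae ?_
    have hne : ∀ᵐ γ : ℝ, γ ≠ E.b := by simp [ae_iff, measure_singleton]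
    filter_upwards [hUac.ae_differentiableAt, hne] with γ hγ hγb hmem
    have hd' := hγ (uIoc_subset_uIcc hmem)
    rw [uIoc_of_le hab] at hmem
    rw [hd γ ⟨hmem.1, lt_of_le_of_ne hmem.2 hγb⟩ hd']
  rw [hset, hset, h1, h2, hUac.integral_mul_deriv_eq_deriv_mul hGac, G_a, hE.G_b]
  simp only [mul_sub, mul_one]
  rw [intervalIntegral.integral_sub hUac.intervalIntegrable_deriv
    (hUac.intervalIntegrable_deriv.mul_continuousOn hGac.continuousOn),
    hUac.integral_deriv_eq_sub]
  ring

end Distribution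

section Revenue

variable {n : ℕ} {E : Environment (n + 1)} {M : Mechanism (n + 1)}

/-- The density `φ^j(γ, θ^j) f(θ|γ) g(γ)` of the virtual surplus from good `j`. -/
noncomputable def surplusDensity (E : Environment (n + 1)) (j : Fin (n + 1))
    (p : ℝ × (Fin (n + 1) → ℝ)) : ℝ :=
  E.virtualValue j p.1 (p.2 j) * E.f p.1 p.2 * E.g p.1

theorem IsSmooth.virtualValue_mul_g (hE : E.IsSmooth) (j : Fin (n + 1)) {γ : ℝ}
    (hγ : γ ∈ E.types) (x : ℝ) :
    E.virtualValue j γ x * E.g γ = x * E.g γ - E.velocity j γ x * (1 - E.G γ) := by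
  have h := (hE.g_pos γ hγ).ne'
  rw [virtualValue, velocity, add_mul, mul_assoc _ _ (E.g γ), div_mul_cancel₀ _ h]
  ring

theorem continuousOn_coord (j : Fin (n + 1)) :
    ContinuousOn (fun p : ℝ × (Fin (n + 1) → ℝ) => p.2 j) (E.types ×ˢ E.values) := by
  fun_prop

theorem velocity_coord_continuousOn (hE : E.IsSmooth) {j : Fin (n + 1)}
    (hreg : E.IsRegularMarginal j) :
    ContinuousOn (fun p : ℝ × (Fin (n + 1) → ℝ) => E.velocity j p.1 (p.2 j))
      (E.types ×ˢ E.values) :=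
  (velocity_continuousOn hE hreg).comp (f := fun p : ℝ × (Fin (n + 1) → ℝ) => (p.1, p.2 j))
    (by fun_prop) fun _ hp => mk_mem_prod hp.1 (coord_mem hp.2 j)

theorem integrable_surplusDensity (hE : E.IsSmooth) {j : Fin (n + 1)}
    (hreg : E.IsRegularMarginal j) : Integrable (E.surplusDensity j) E.joint := by
  obtain ⟨C, hC⟩ := exists_velocity_bound hE hreg
  have h1 := hE.integrable_joint
    (aestronglyMeasurable_joint_of_continuousOn (E := E) (continuousOn_coord j))
    (fun p hp => abs_coord_le hp.2 j) hE.g_integrable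
  have h2 := hE.integrable_joint
    (aestronglyMeasurable_joint_of_continuousOn (velocity_coord_continuousOn hE hreg))
    (fun p hp => hC p.1 hp.1 _ (coord_mem hp.2 j)) hE.one_sub_G_integrableOn
  refine (h1.sub h2).congr ?_
  filter_upwards [E.ae_joint_mem] with p hp
  have h := hE.virtualValue_mul_g j hp.1 (p.2 j)
  simp only [Pi.sub_apply, surplusDensity]
  linear_combination (-E.f p.1 p.2) * h

theorem Feasible.measurable_q_apply (hM : E.Feasible M) (j : Fin (n + 1)) :
    Measurable fun p : ℝ × (Fin (n + 1) → ℝ) => M.q p.1 p.2 j :=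
  (measurable_pi_apply j).comp hM.q_measurable

theorem Feasible.integrable_q_mul_surplusDensity (hM : E.Feasible M) (hE : E.IsSmooth)
    {j : Fin (n + 1)} (hreg : E.IsRegularMarginal j) :
    Integrable (fun p => M.q p.1 p.2 j * E.surplusDensity j p) E.joint := by
  refine (integrable_surplusDensity hE hreg).bdd_mul (c := 1)
    (hM.measurable_q_apply j).aestronglyMeasurable ?_
  filter_upwards [E.ae_joint_mem] with p hp
  have h := hM.q_mem p.1 hp.1 p.2 hp.2 j
  rw [Real.norm_eq_abs, abs_of_nonneg h.1]
  exact h.2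

/-- Revenue is the expected virtual surplus of the allocation less the rent of the lowest type. -/
theorem Feasible.revenue_eq (hM : E.Feasible M) (hE : E.IsSmooth)
    (hreg : ∀ j, E.IsRegularMarginal j) (hinv : E.InvariantDependencies) :
    E.revenue M = -E.rent M E.a + ∑ j, ∫ p, M.q p.1 p.2 j * E.surplusDensity j p ∂E.joint := by
  obtain ⟨c, hc⟩ := hinv
  obtain ⟨K, hK⟩ := hM.exists_rent_lipschitz hE hreg hc
  choose C hC using fun j => exists_velocity_bound hE (hreg j)
  set k₁ : ℝ × (Fin (n + 1) → ℝ) → ℝ := fun p => ∑ i, M.q p.1 p.2 i * p.2 i with hk₁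
  set k₂ : ℝ × (Fin (n + 1) → ℝ) → ℝ := fun p => ∑ i, M.q p.1 p.2 i * E.velocity i p.1 (p.2 i)
    with hk₂
  have hk₁m : AEStronglyMeasurable k₁ E.joint :=
    Finset.aestronglyMeasurable_fun_sum _ fun i _ =>
      (hM.measurable_q_apply i).aestronglyMeasurable.mul
        (aestronglyMeasurable_joint_of_continuousOn (continuousOn_coord i))
  have hk₂m : AEStronglyMeasurable k₂ E.joint :=
    Finset.aestronglyMeasurable_fun_sum _ fun i _ =>
      (hM.measurable_q_apply i).aestronglyMeasurable.mul
        (aestronglyMeasurable_joint_of_continuousOn (velocity_coord_continuousOn hE (hreg i)))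
  have hk₁b : ∀ p ∈ E.types ×ˢ E.values, |k₁ p| ≤ ∑ i, (|E.lo i| + |E.hi i|) := fun p hp =>
    hM.abs_sum_q_mul_le hp.1 hp.2
  have hk₂b : ∀ p ∈ E.types ×ˢ E.values, |k₂ p| ≤ ∑ i, C i := fun p hp =>
    abs_sum_mul_le (hM.q_mem p.1 hp.1 p.2 hp.2) fun i => hC i p.1 hp.1 _ (coord_mem hp.2 i)
  obtain ⟨hi₁, he₁⟩ := hE.integral_joint hk₁m hk₁b hE.g_integrable
  obtain ⟨-, he₂⟩ := hE.integral_joint hk₂m hk₂b hE.one_sub_G_integrableOn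
  have hrent := hE.integral_mul_g hK fun γ hγ hd => hM.deriv_rent_eq hE hreg hc hγ hd
  have hrent_int : IntegrableOn (fun γ => E.rent M γ * E.g γ) E.types :=
    hE.g_integrable.continuousOn_mul hK.continuousOn isCompact_Icc
  have h1 : E.revenue M = (∫ γ in E.types, E.condExp γ (fun θ => k₁ (γ, θ)) * E.g γ) -
      ∫ γ in E.types, E.rent M γ * E.g γ := by
    rw [revenue, ← integral_sub hi₁ hrent_int]
    refine setIntegral_congr_fun measurableSet_Icc fun γ hγ => ?_
    have hm : Measurable fun θ => k₁ (γ, θ) :=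
      Finset.measurable_sum _ fun i _ =>
        (hM.measurable_q_right γ i).mul (measurable_pi_apply i)
    have hint := hE.integrable_law_of_bound hγ hm.aestronglyMeasurable
      fun θ hθ => hk₁b (γ, θ) (mk_mem_prod hγ hθ)
    simp only [t1_add_t2_eq]
    rw [← sub_mul, rent, hE.condExp_eq_integral_law hγ, hE.condExp_eq_integral_law hγ,
      hE.condExp_eq_integral_law hγ, ← integral_sub hint (hM.integrable_payoff hE hγ hγ)]
  have h2 : (∫ p, k₁ p * E.f p.1 p.2 * E.g p.1 ∂E.joint) -
      (∫ p, k₂ p * E.f p.1 p.2 * (1 - E.G p.1) ∂E.joint) =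
      ∑ j, ∫ p, M.q p.1 p.2 j * E.surplusDensity j p ∂E.joint := by
    rw [← integral_sub (hE.integrable_joint hk₁m hk₁b hE.g_integrable)
      (hE.integrable_joint hk₂m hk₂b hE.one_sub_G_integrableOn),
      ← integral_finsetSum _ fun j _ => hM.integrable_q_mul_surplusDensity hE (hreg j)]
    refine integral_congr_ae ?_
    filter_upwards [E.ae_joint_mem] with p hp
    simp only [hk₁, hk₂, Finset.sum_mul, ← Finset.sum_sub_distrib]
    refine Finset.sum_congr rfl fun j _ => ?_
    have h := hE.virtualValue_mul_g j hp.1 (p.2 j)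
    rw [surplusDensity]
    linear_combination (-M.q p.1 p.2 j * E.f p.1 p.2) * h
  rw [h1, hrent, ← he₁, ← h2, he₂]
  ring

end Revenue

end Environment

/-! ### The cutoff mechanism for one good -/

namespace Environment

section Cutoff

variable {n : ℕ} {E : Environment (n + 1)} {j : Fin (n + 1)}

/-- The smallest valuation with nonnegative virtual value; the inserted point above `hi j` is the
value when there is none. -/
noncomputable def cutoff (E : Environment (n + 1)) (j : Fin (n + 1)) (γ : ℝ) : ℝ :=
  sInf (insert (E.hi j + 1) {x ∈ Icc (E.lo j) (E.hi j) | 0 ≤ E.virtualValue j γ x})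

theorem bddBelow_cutoff_set (γ : ℝ) :
    BddBelow (insert (E.hi j + 1) {x ∈ Icc (E.lo j) (E.hi j) | 0 ≤ E.virtualValue j γ x}) :=
  (bddBelow_Icc.mono (sep_subset _ _)).insert _

theorem lo_le_cutoff (hE : E.IsSmooth) (γ : ℝ) : E.lo j ≤ E.cutoff j γ := by
  refine le_csInf (insert_nonempty _ _) fun x hx => ?_
  rcases hx with rfl | hx
  · linarith [hE.lo_lt_hi j]
  · exact hx.1.1

theorem cutoff_antitoneOn (hreg : E.IsRegularMarginal j) :
    AntitoneOn (E.cutoff j) E.types := by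
  intro γ hγ γ' hγ' h
  exact csInf_le_csInf (bddBelow_cutoff_set γ') (insert_nonempty _ _)
    (insert_subset_insert fun x hx => ⟨hx.1, hx.2.trans (hreg.monotone x hx.1 hγ hγ' h)⟩)

theorem virtualValue_continuousOn (hE : E.IsSmooth) (hreg : E.IsRegularMarginal j) {γ : ℝ}
    (hγ : γ ∈ E.types) : ContinuousOn (E.virtualValue j γ) (Icc (E.lo j) (E.hi j)) := by
  have h : ContinuousOn (fun x => E.margCDFDeriv j γ x) (Icc (E.lo j) (E.hi j)) :=
    (hE.margCDFDeriv_continuousOn j).comp (f := fun x : ℝ => (γ, x)) (by fun_prop)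
      fun _ hx => ⟨hγ, hx⟩
  exact continuousOn_id.add ((h.div (hE.margDensity_continuousOn_right j hγ)
    fun x hx => (hreg.density_pos γ hγ x hx).ne').mul continuousOn_const)

theorem cutoff_le_iff (hE : E.IsSmooth) (hreg : E.IsRegularMarginal j) {γ x : ℝ}
    (hγ : γ ∈ E.types) (hx : x ∈ Icc (E.lo j) (E.hi j)) :
    E.cutoff j γ ≤ x ↔ 0 ≤ E.virtualValue j γ x := by
  refine ⟨fun h => ?_, fun h =>
    csInf_le (bddBelow_cutoff_set γ) (mem_insert_of_mem _ ⟨hx, h⟩)⟩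
  have hclosed : IsClosed {x ∈ Icc (E.lo j) (E.hi j) | 0 ≤ E.virtualValue j γ x} :=
    (virtualValue_continuousOn hE hreg hγ).preimage_isClosed_of_isClosed isClosed_Icc isClosed_Ici
  have hmem : E.cutoff j γ ∈
      insert (E.hi j + 1) {x ∈ Icc (E.lo j) (E.hi j) | 0 ≤ E.virtualValue j γ x} := by
    have := (isClosed_singleton (x := E.hi j + 1)).union hclosed
    rw [← insert_eq] at this
    exact this.csInf_mem (insert_nonempty _ _) (bddBelow_cutoff_set γ)
  rcases hmem with h1 | h1
  · linarith [hx.2]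
  · exact hreg.single_crossing γ hγ _ h1.1 x hx h h1.2

/-- The expected value `C γ z` of `(θ^j - z)⁺` given `γ` and its derivative `K γ z` in `γ`.
An increase of the type shifts the distribution upwards, so `K` is antitone in `z`. -/
theorem exists_expected_excess (hE : E.IsSmooth) (hreg : E.IsRegularMarginal j) :
    ∃ C K : ℝ → ℝ → ℝ, Continuous (uncurry C) ∧ Continuous (uncurry K) ∧
      (∀ γ ∈ E.types, ∀ z ∈ Icc (E.lo j) (E.hi j),
        ∫ x in Icc (E.lo j) (E.hi j), max (x - z) 0 * E.margDensity j γ x = C γ z) ∧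
      (∀ γ ∈ E.types, ∀ γ' ∈ E.types, ∀ z ∈ Icc (E.lo j) (E.hi j),
        C γ z - C γ' z = ∫ s in γ'..γ, K s z) ∧
      (∀ s ∈ E.types, AntitoneOn (K s) (Icc (E.lo j) (E.hi j))) ∧
      ∀ s, K s (E.hi j) = 0 := by
  obtain ⟨d, -, -, hd, -, hdeq, -⟩ := hE.exists_marg_eq_integral j
  obtain ⟨Φ, P, hΦ, -, hΦeq, hF⟩ := hE.exists_margCDFDeriv j
  have hlh := (hE.lo_lt_hi j).le
  have hΦx : ∀ x, Continuous fun s => Φ s x := fun x =>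
    hΦ.comp (by fun_prop : Continuous fun s => (s, x))
  have hΦs : ∀ s, Continuous fun x => Φ s x := fun s =>
    hΦ.comp (by fun_prop : Continuous fun x => (s, x))
  have hdγ : ∀ γ, Continuous fun x => d γ x := fun γ =>
    hd.comp (by fun_prop : Continuous fun x => (γ, x))
  refine ⟨fun γ z => ∫ x in E.hi j..z, -((x - z) * d γ x), fun s z => ∫ x in E.hi j..z, Φ s x,
    ?_, ?_, ?_, ?_, ?_, ?_⟩
  · apply intervalIntegral.continuous_parametric_intervalIntegral_of_continuous
      (f := fun (p : ℝ × ℝ) x => -((x - p.2) * d p.1 x)) _ continuous_snd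
    have h1 : Continuous fun q : (ℝ × ℝ) × ℝ => d q.1.1 q.2 :=
      hd.comp (by fun_prop : Continuous fun q : (ℝ × ℝ) × ℝ => (q.1.1, q.2))
    have h2 : Continuous fun q : (ℝ × ℝ) × ℝ => q.2 - q.1.2 := by fun_prop
    exact (h2.mul h1).neg
  · apply intervalIntegral.continuous_parametric_intervalIntegral_of_continuous
      (f := fun (p : ℝ × ℝ) x => Φ p.1 x) _ continuous_snd
    exact hΦ.comp (by fun_prop : Continuous fun q : (ℝ × ℝ) × ℝ => (q.1.1, q.2))
  · intro γ hγ z hz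
    have hc : Continuous fun x => max (x - z) 0 * d γ x := by
      have := hdγ γ
      fun_prop
    have h1 : ∫ x in Icc (E.lo j) (E.hi j), max (x - z) 0 * E.margDensity j γ x =
        ∫ x in E.lo j..E.hi j, max (x - z) 0 * d γ x := by
      rw [intervalIntegral.integral_of_le hlh, ← integral_Icc_eq_integral_Ioc]
      refine setIntegral_congr_fun measurableSet_Icc fun x hx => ?_
      simp only [hdeq γ hγ x hx]
    have h2 : ∫ x in E.lo j..z, max (x - z) 0 * d γ x = 0 := by
      rw [intervalIntegral.integral_congr (g := fun _ => 0), intervalIntegral.integral_zero]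
      intro x hx
      rw [uIcc_of_le hz.1] at hx
      simp [max_eq_right (sub_nonpos.2 hx.2)]
    have h3 : ∫ x in z..E.hi j, max (x - z) 0 * d γ x = ∫ x in z..E.hi j, (x - z) * d γ x := by
      refine intervalIntegral.integral_congr fun x hx => ?_
      rw [uIcc_of_le hz.2] at hx
      simp only [max_eq_left (sub_nonneg.2 hx.1)]
    rw [h1, ← intervalIntegral.integral_add_adjacent_intervals (hc.intervalIntegrable _ z)
      (hc.intervalIntegrable z _), h2, h3, zero_add]
    beta_reduce
    rw [intervalIntegral.integral_neg, intervalIntegral.integral_symm z, neg_neg]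
  · intro γ hγ γ' hγ' z hz
    -- Integration by parts turns the expected excess into `∫ (1 - F^j)` over `[z, hi j]`.
    have hparts : ∀ γ ∈ E.types, ∫ x in E.hi j..z, -((x - z) * d γ x) =
        (E.hi j - z) * E.margCDF j γ (E.hi j) + ∫ x in E.hi j..z, E.margCDF j γ x := by
      intro γ hγ
      have hcdf : ∀ x ∈ Icc (E.lo j) (E.hi j),
          E.margCDF j γ x = ∫ y in E.lo j..x, d γ y := by
        intro x hx
        refine intervalIntegral.integral_congr fun y hy => ?_
        rw [uIcc_of_le hx.1] at hy
        exact hdeq γ hγ y ⟨hy.1, hy.2.trans hx.2⟩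
      have hsub : ∀ x ∈ uIcc (E.hi j) z, x ∈ Icc (E.lo j) (E.hi j) := fun x hx =>
        uIcc_subset_Icc (hE.hi_mem j) hz hx
      have hibp := intervalIntegral.integral_mul_deriv_eq_deriv_mul (a := E.hi j) (b := z)
        (u := fun x => x - z) (v := fun x => ∫ y in E.lo j..x, d γ y) (u' := fun _ => 1)
        (v' := d γ) (fun x _ => (hasDerivAt_id x).sub_const z)
        (fun x _ => ((hdγ γ).integral_hasStrictDerivAt (E.lo j) x).hasDerivAt)
        (intervalIntegrable_const) ((hdγ γ).intervalIntegrable _ _)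
      rw [intervalIntegral.integral_neg, hibp, hcdf _ (hE.hi_mem j),
        intervalIntegral.integral_congr fun x hx => hcdf x (hsub x hx)]
      simp only [one_mul, sub_self, zero_mul]
      ring
    have hcont : ∀ γ ∈ E.types,
        IntervalIntegrable (E.margCDF j γ) volume (E.hi j) z := fun γ hγ =>
      ((hE.margCDF_continuousOn j hγ).mono
        (uIcc_subset_Icc (hE.hi_mem j) hz)).intervalIntegrable
    beta_reduce
    rw [hparts γ hγ, hparts γ' hγ', hE.margCDF_hi j hγ, hE.margCDF_hi j hγ', add_sub_add_left_eq_sub,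
      ← intervalIntegral.integral_sub (hcont γ hγ) (hcont γ' hγ')]
    have hdiff : ∫ x in E.hi j..z, (E.margCDF j γ x - E.margCDF j γ' x) =
        ∫ x in E.hi j..z, ∫ s in γ'..γ, Φ s x := by
      refine intervalIntegral.integral_congr fun x hx => ?_
      have hx' := uIcc_subset_Icc (hE.hi_mem j) hz hx
      simp only [hF γ hγ x hx', hF γ' hγ' x hx', add_sub_add_left_eq_sub]
      exact intervalIntegral.integral_interval_sub_left
        ((hΦx x).intervalIntegrable _ _) ((hΦx x).intervalIntegrable _ _)
    rw [hdiff]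
    have hswap := integral_integral_swap_of_continuous (μ := volume) hΦ γ' γ
      (isCompact_Icc (a := z) (b := E.hi j))
      measurableSet_Icc
    simp only [integral_Icc_eq_integral_Ioc, ← intervalIntegral.integral_of_le hz.2] at hswap
    rw [intervalIntegral.integral_symm, hswap, ← intervalIntegral.integral_neg]
    exact intervalIntegral.integral_congr fun s _ => (intervalIntegral.integral_symm _ _).symm
  · intro s hs y hy z hz hyz
    have h := intervalIntegral.integral_add_adjacent_intervals
      ((hΦs s).intervalIntegrable (μ := volume) (E.hi j) y) ((hΦs s).intervalIntegrable y z)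
    have h2 : ∫ x in y..z, Φ s x ≤ 0 := by
      have := intervalIntegral.integral_mono_on hyz ((hΦs s).intervalIntegrable (μ := volume) y z)
        (intervalIntegrable_const (c := (0 : ℝ))) fun x hx => by
          have hx' : x ∈ Icc (E.lo j) (E.hi j) := ⟨hy.1.trans hx.1, hx.2.trans hz.2⟩
          rw [← hΦeq s hs x hx']
          exact hreg.deriv_nonpos s hs x hx'
      simpa using this
    beta_reduce
    linarith
  · intro s
    exact intervalIntegral.integral_same

/-- The mechanism that sells good `j` exactly when its virtual value is nonnegative is feasible in
the one-good problem and leaves no rent to the lowest type. Each type buys an option with strike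
price `cutoff`; since higher types get lower strike prices, upfront payments that leave the rent
given by the envelope formula make the menu incentive compatible. -/
theorem exists_cutoff_mechanism (hE : E.IsSmooth) (hreg : E.IsRegularMarginal j) :
    ∃ M : Mechanism 1, (E.oneGood j).Feasible M ∧ (E.oneGood j).rent M E.a = 0 ∧
      ∀ γ ∈ E.types, ∀ θ ∈ (E.oneGood j).values,
        M.q γ θ 0 = if 0 ≤ E.virtualValue j γ (θ 0) then 1 else 0 := by
  obtain ⟨C, K, hC, hK, hCeq, hCsub, hKanti, hKhi⟩ := exists_expected_excess hE hreg
  have hab := hE.a_lt_b.le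
  have hlh := (hE.lo_lt_hi j).le
  have hclamp : ∀ γ, E.a ⊔ E.b ⊓ γ ∈ E.types := lo_sup_hi_inf_mem_Icc hab
  -- The cutoff is made antitone, hence measurable, on the whole line.
  set p : ℝ → ℝ := fun γ => E.cutoff j (E.a ⊔ E.b ⊓ γ) with hp
  have hpanti : Antitone p := fun γ γ' h =>
    cutoff_antitoneOn hreg (hclamp γ) (hclamp γ') (sup_le_sup_left (inf_le_inf_left _ h) _)
  have hpmeas : Measurable p := hpanti.measurable
  have hpeq : ∀ γ ∈ E.types, p γ = E.cutoff j γ := fun γ hγ => by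
    simp only [hp, lo_sup_hi_inf_eq_self hγ]
  set z : ℝ → ℝ := fun γ => min (p γ) (E.hi j) with hz
  have hzanti : Antitone z := fun γ γ' h => min_le_min_right _ (hpanti h)
  have hzmeas : Measurable z := hzanti.measurable
  have hzmem : ∀ γ, z γ ∈ Icc (E.lo j) (E.hi j) := fun γ =>
    ⟨le_min (lo_le_cutoff hE _) hlh, min_le_right _ _⟩
  -- The slope of the rent, extended to a bounded function on the line.
  set κ : ℝ → ℝ := fun s => K (E.a ⊔ E.b ⊓ s) (z s) with hκ
  have hκeq : ∀ s ∈ E.types, κ s = K s (z s) := fun s hs => by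
    simp only [hκ, lo_sup_hi_inf_eq_self hs]
  have hκmeas : Measurable κ := by
    refine hK.measurable.comp (Measurable.prodMk ?_ hzmeas)
    exact (by fun_prop : Continuous fun s => E.a ⊔ E.b ⊓ s).measurable
  have hκint : ∀ s t, IntervalIntegrable κ volume s t := by
    obtain ⟨D, hD⟩ := (isCompact_Icc.prod isCompact_Icc :
      IsCompact (E.types ×ˢ Icc (E.lo j) (E.hi j))).exists_bound_of_continuousOn hK.continuousOn
    intro s t
    refine (intervalIntegrable_const (c := D)).mono_fun hκmeas.aestronglyMeasurable
      (Eventually.of_forall fun x => ?_)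
    exact (hD (E.a ⊔ E.b ⊓ x, z x) (mk_mem_prod (hclamp x) (hzmem x))).trans (le_abs_self D)
  have hκnonneg : ∀ s ∈ E.types, 0 ≤ κ s := fun s hs => by
    rw [hκeq s hs, ← hKhi s]
    exact hKanti s hs (hzmem s) (hE.hi_mem j) (hzmem s).2
  set U : ℝ → ℝ := fun γ => ∫ s in E.a..γ, κ s with hU
  let M : Mechanism 1 :=
    { q := fun γ θ _ => if p γ ≤ θ 0 then 1 else 0
      t1 := fun γ => C γ (z γ) - U γ
      t2 := fun γ θ => if p γ ≤ θ 0 then p γ else 0 }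
  have hpay : ∀ γ, ∀ θ ∈ (E.oneGood j).values,
      M.payoff γ θ = max (θ 0 - z γ) 0 - (C γ (z γ) - U γ) := by
    intro γ θ hθ
    have hθhi : θ 0 ≤ E.hi j := hθ.2 0
    simp only [Mechanism.payoff, M, Finset.univ_unique, Fin.default_eq_zero, Finset.sum_singleton,
      hz]
    by_cases h : p γ ≤ θ 0
    · rw [if_pos h, if_pos h, min_eq_left (h.trans hθhi), max_eq_left (sub_nonneg.2 h)]
      ring
    · rw [if_neg h, if_neg h, max_eq_right (sub_nonpos.2 (le_min (not_le.1 h).le hθhi))]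
      ring
  have hmeasle : MeasurableSet {r : ℝ × (Fin 1 → ℝ) | p r.1 ≤ r.2 0} :=
    measurableSet_le (hpmeas.comp measurable_fst)
      ((measurable_pi_apply 0).comp measurable_snd)
  have hic2 : ∀ γ ∈ (E.oneGood j).types, ∀ θ ∈ (E.oneGood j).values,
      ∀ θ' ∈ (E.oneGood j).values,
      (∑ i, M.q γ θ' i * θ i) - M.t2 γ θ' ≤ (∑ i, M.q γ θ i * θ i) - M.t2 γ θ := by
    intro γ _ θ _ θ' _
    simp only [M, Finset.univ_unique, Fin.default_eq_zero, Finset.sum_singleton]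
    split_ifs <;> linarith
  have hexp : ∀ γ ∈ E.types, ∀ γ' ∈ E.types, (E.oneGood j).condExp γ (M.payoff γ') =
      C γ (z γ') - (C γ' (z γ') - U γ') := by
    intro γ hγ γ' hγ'
    rw [condExp_oneGood_eq_integral, ← hCeq γ hγ _ (hzmem γ')]
    have hdens := hE.margDensity_continuousOn_right j hγ
    have h1 : IntegrableOn (fun x => max (x - z γ') 0 * E.margDensity j γ x)
        (Icc (E.lo j) (E.hi j)) :=
      (ContinuousOn.mul (by fun_prop) hdens).integrableOn_compact isCompact_Icc
    have h2 : IntegrableOn (fun x => (C γ' (z γ') - U γ') * E.margDensity j γ x)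
        (Icc (E.lo j) (E.hi j)) :=
      (continuousOn_const.mul hdens).integrableOn_compact isCompact_Icc
    have h3 : ∫ x in Icc (E.lo j) (E.hi j), E.margDensity j γ x = 1 := by
      rw [← hE.margCDF_hi j hγ, margCDF, intervalIntegral.integral_of_le hlh,
        integral_Icc_eq_integral_Ioc]
    rw [setIntegral_congr_fun measurableSet_Icc (g := fun x =>
      max (x - z γ') 0 * E.margDensity j γ x - (C γ' (z γ') - U γ') * E.margDensity j γ x)
      fun x hx => ?_, integral_sub h1 h2, integral_const_mul, h3, mul_one]
    simp only [hpay γ' (fun _ => x) ⟨fun _ => hx.1, fun _ => hx.2⟩, sub_mul]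
  refine ⟨M, ⟨?_, ?_, ?_, ?_, ?_, hic2, ?_⟩, ?_, ?_⟩
  · exact measurable_pi_iff.2 fun _ => Measurable.ite hmeasle measurable_const measurable_const
  · exact (hC.measurable.comp (measurable_id.prodMk hzmeas)).sub
      (intervalIntegral.continuous_primitive hκint E.a).measurable
  · exact Measurable.ite hmeasle (hpmeas.comp measurable_fst) measurable_const
  · intro γ _ θ _ _
    simp only [M]
    split_ifs <;> simp
  · intro γ hγ γ' hγ'
    rw [deviationPayoff_eq hic2 hγ', deviationPayoff_eq hic2 hγ, hexp γ hγ γ' hγ',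
      hexp γ hγ γ hγ]
    have hKint : ∀ s t, IntervalIntegrable (fun r => K r (z γ')) volume s t := fun s t =>
      (hK.comp (by fun_prop : Continuous fun r => (r, z γ'))).intervalIntegrable _ _
    have hUsub : U γ - U γ' = ∫ s in γ'..γ, κ s :=
      intervalIntegral.integral_interval_sub_left (hκint _ _) (hκint _ _)
    have hmain : ∫ s in γ'..γ, K s (z γ') ≤ ∫ s in γ'..γ, κ s := by
      rcases le_total γ' γ with h | h
      · refine intervalIntegral.integral_mono_on h (hKint _ _) (hκint _ _) fun s hs => ?_
        have hs' : s ∈ E.types := ⟨hγ'.1.trans hs.1, hs.2.trans hγ.2⟩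
        rw [hκeq s hs']
        exact hKanti s hs' (hzmem s) (hzmem γ') (hzanti hs.1)
      · rw [intervalIntegral.integral_symm, intervalIntegral.integral_symm γ]
        refine neg_le_neg (intervalIntegral.integral_mono_on h (hκint _ _) (hKint _ _)
          fun s hs => ?_)
        have hs' : s ∈ E.types := ⟨hγ.1.trans hs.1, hs.2.trans hγ'.2⟩
        rw [hκeq s hs']
        exact hKanti s hs' (hzmem γ') (hzmem s) (hzanti hs.2)
    have := hCsub γ hγ γ' hγ' _ (hzmem γ')
    linarith
  · intro γ hγ
    change 0 ≤ (E.oneGood j).condExp γ (M.payoff γ)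
    rw [hexp γ hγ γ hγ, sub_sub_cancel]
    exact intervalIntegral.integral_nonneg hγ.1 fun s hs => hκnonneg s ⟨hs.1, hs.2.trans hγ.2⟩
  · have ha : E.a ∈ E.types := ⟨le_rfl, hab⟩
    rw [rent, hexp E.a ha E.a ha, sub_sub_cancel]
    exact intervalIntegral.integral_same
  · intro γ hγ θ hθ
    simp only [M, hpeq γ hγ, cutoff_le_iff hE hreg hγ ⟨hθ.1 0, hθ.2 0⟩]

end Cutoff

end Environment

/-! ### Optimal mechanisms -/

namespace Environment

section Optimal

variable {n : ℕ} {E : Environment (n + 1)}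

/-- The largest conceivable expected virtual surplus from good `j`. -/
noncomputable def maxSurplus (E : Environment (n + 1)) (j : Fin (n + 1)) : ℝ :=
  ∫ p, max (E.surplusDensity j p) 0 ∂E.joint

theorem mul_le_max_zero {q s : ℝ} (hq : q ∈ Icc (0 : ℝ) 1) : q * s ≤ max s 0 := by
  rcases le_total 0 s with h | h
  · exact (mul_le_of_le_one_left h hq.2).trans (le_max_left _ _)
  · exact (mul_nonpos_of_nonneg_of_nonpos hq.1 h).trans (le_max_right _ _)

theorem Feasible.q_mul_surplusDensity_le {M : Mechanism (n + 1)} (hM : E.Feasible M)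
    (j : Fin (n + 1)) :
    ∀ᵐ p ∂E.joint, M.q p.1 p.2 j * E.surplusDensity j p ≤ max (E.surplusDensity j p) 0 := by
  filter_upwards [E.ae_joint_mem] with p hp
  exact mul_le_max_zero (hM.q_mem p.1 hp.1 p.2 hp.2 j)

theorem Feasible.integral_q_mul_surplusDensity_le {M : Mechanism (n + 1)} (hM : E.Feasible M)
    (hE : E.IsSmooth) {j : Fin (n + 1)} (hreg : E.IsRegularMarginal j) :
    ∫ p, M.q p.1 p.2 j * E.surplusDensity j p ∂E.joint ≤ E.maxSurplus j :=
  integral_mono_ae (hM.integrable_q_mul_surplusDensity hE hreg)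
    (integrable_surplusDensity hE hreg).pos_part (hM.q_mul_surplusDensity_le j)

theorem Feasible.rent_nonneg {m : ℕ} {E : Environment m} {M : Mechanism m} (hM : E.Feasible M)
    {γ : ℝ} (hγ : γ ∈ E.types) : 0 ≤ E.rent M γ :=
  hM.ir γ hγ

theorem IsSmooth.a_mem {m : ℕ} {E : Environment m} (hE : E.IsSmooth) : E.a ∈ E.types :=
  ⟨le_rfl, hE.a_lt_b.le⟩

theorem Feasible.revenue_le (hE : E.IsSmooth) (hreg : ∀ j, E.IsRegularMarginal j)
    (hinv : E.InvariantDependencies) {M : Mechanism (n + 1)} (hM : E.Feasible M) :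
    E.revenue M ≤ ∑ j, E.maxSurplus j := by
  rw [hM.revenue_eq hE hreg hinv]
  have h1 := hM.rent_nonneg hE.a_mem
  have h2 := Finset.sum_le_sum fun j (_ : j ∈ Finset.univ) =>
    hM.integral_q_mul_surplusDensity_le hE (hreg j)
  linarith

/-- A one-good mechanism can be studied inside the joint problem, by selling no other good. -/
theorem revenue_oneGood_eq (hE : E.IsSmooth) (hreg : ∀ j, E.IsRegularMarginal j)
    (hinv : E.InvariantDependencies) {j : Fin (n + 1)} {M : Mechanism 1}
    (hM : (E.oneGood j).Feasible M) :
    (E.oneGood j).revenue M = -(E.oneGood j).rent M E.a +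
      ∫ p, M.q p.1 (fun _ => p.2 j) 0 * E.surplusDensity j p ∂E.joint := by
  rw [← revenue_only hE hM, (feasible_only hE hM).revenue_eq hE hreg hinv,
    Finset.sum_eq_single j (fun i _ hi => by simp [only_q_of_ne hi]) (by simp)]
  simp only [only_q_self]
  rw [rent, condExp_payoff_only hE hM hE.a_mem, rent]

theorem revenue_oneGood_le (hE : E.IsSmooth) (hreg : ∀ j, E.IsRegularMarginal j)
    (hinv : E.InvariantDependencies) {j : Fin (n + 1)} {M : Mechanism 1}
    (hM : (E.oneGood j).Feasible M) : (E.oneGood j).revenue M ≤ E.maxSurplus j := by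
  rw [revenue_oneGood_eq hE hreg hinv hM]
  have h1 : 0 ≤ (E.oneGood j).rent M E.a := hM.ir E.a hE.a_mem
  have h2 := (feasible_only hE hM).integral_q_mul_surplusDensity_le hE (hreg j)
  simp only [only_q_self] at h2
  linarith

/-- The revenue of separate sales is the sum of the revenues of the one-good mechanisms. -/
theorem revenue_separate (hE : E.IsSmooth) (hreg : ∀ j, E.IsRegularMarginal j)
    (hinv : E.InvariantDependencies) {M : Fin (n + 1) → Mechanism 1}
    (hM : ∀ j, (E.oneGood j).Feasible (M j)) :
    E.revenue (Mechanism.separate M) = ∑ j, (E.oneGood j).revenue (M j) := by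
  rw [(feasible_separate hE hM).revenue_eq hE hreg hinv, rent,
    condExp_payoff_separate hE hM hE.a_mem hE.a_mem, ← Finset.sum_neg_distrib,
    ← Finset.sum_add_distrib]
  refine Finset.sum_congr rfl fun j _ => ?_
  rw [revenue_oneGood_eq hE hreg hinv (hM j)]
  rfl

theorem ite_mul_surplusDensity (hE : E.IsSmooth) (j : Fin (n + 1))
    {p : ℝ × (Fin (n + 1) → ℝ)} (hp : p ∈ E.types ×ˢ E.values) :
    (if 0 ≤ E.virtualValue j p.1 (p.2 j) then 1 else 0) * E.surplusDensity j p =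
      max (E.surplusDensity j p) 0 := by
  have hf := hE.f_nonneg p.1 hp.1 p.2 hp.2
  have hg := (hE.g_pos p.1 hp.1).le
  rw [surplusDensity]
  split_ifs with h
  · rw [one_mul, max_eq_left (mul_nonneg (mul_nonneg h hf) hg)]
  · rw [zero_mul, max_eq_right
      (mul_nonpos_of_nonpos_of_nonneg (mul_nonpos_of_nonpos_of_nonneg (not_le.1 h).le hf) hg)]

/-- The cutoff mechanism collects the whole positive part of the virtual surplus. -/
theorem exists_optimal_oneGood (hE : E.IsSmooth) (hreg : ∀ j, E.IsRegularMarginal j)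
    (hinv : E.InvariantDependencies) (j : Fin (n + 1)) :
    ∃ M : Mechanism 1, (E.oneGood j).IsOptimal M ∧ (E.oneGood j).revenue M = E.maxSurplus j ∧
      ∀ γ ∈ E.types, ∀ θ ∈ (E.oneGood j).values,
        M.q γ θ 0 = if 0 ≤ E.virtualValue j γ (θ 0) then 1 else 0 := by
  obtain ⟨M, hM, hrent, hq⟩ := exists_cutoff_mechanism hE (hreg j)
  have hrev : (E.oneGood j).revenue M = E.maxSurplus j := by
    rw [revenue_oneGood_eq hE hreg hinv hM, hrent, neg_zero, zero_add]
    refine integral_congr_ae ?_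
    filter_upwards [E.ae_joint_mem] with p hp
    rw [hq p.1 hp.1 _ (const_mem_oneGood_values hp.2 j), ite_mul_surplusDensity hE j hp]
  exact ⟨M, ⟨hM, fun M' hM' => hrev ▸ revenue_oneGood_le hE hreg hinv hM'⟩, hrev, hq⟩

theorem IsOptimal.revenue_oneGood_eq_maxSurplus (hE : E.IsSmooth)
    (hreg : ∀ j, E.IsRegularMarginal j) (hinv : E.InvariantDependencies) {j : Fin (n + 1)}
    {M : Mechanism 1} (hM : (E.oneGood j).IsOptimal M) :
    (E.oneGood j).revenue M = E.maxSurplus j := by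
  obtain ⟨M', hM', hrev, -⟩ := exists_optimal_oneGood hE hreg hinv j
  exact le_antisymm (revenue_oneGood_le hE hreg hinv hM.1) (hrev ▸ hM.2 M' hM'.1)

theorem isOptimal_separate (hE : E.IsSmooth) (hreg : ∀ j, E.IsRegularMarginal j)
    (hinv : E.InvariantDependencies) {M : Fin (n + 1) → Mechanism 1}
    (hM : ∀ j, (E.oneGood j).IsOptimal (M j)) : E.IsOptimal (Mechanism.separate M) := by
  have hfeas := fun j => (hM j).1
  refine ⟨feasible_separate hE hfeas, fun M' hM' => ?_⟩
  rw [revenue_separate hE hreg hinv hfeas, Finset.sum_congr rfl fun j _ =>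
    (hM j).revenue_oneGood_eq_maxSurplus hE hreg hinv]
  exact hM'.revenue_le hE hreg hinv

/-- An optimal mechanism attains the pointwise maximum of the virtual surplus almost
everywhere. -/
theorem IsOptimal.q_mul_surplusDensity_eq (hE : E.IsSmooth) (hreg : ∀ j, E.IsRegularMarginal j)
    (hinv : E.InvariantDependencies) {M : Mechanism (n + 1)} (hM : E.IsOptimal M)
    (j : Fin (n + 1)) :
    ∀ᵐ p ∂E.joint, M.q p.1 p.2 j * E.surplusDensity j p = max (E.surplusDensity j p) 0 := by
  choose M' hM' hrev _ using exists_optimal_oneGood hE hreg hinv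
  have h1 : ∑ j, E.maxSurplus j ≤ E.revenue M := by
    rw [← Finset.sum_congr rfl fun j _ => hrev j,
      ← revenue_separate hE hreg hinv fun j => (hM' j).1]
    exact hM.2 _ (feasible_separate hE fun j => (hM' j).1)
  rw [hM.1.revenue_eq hE hreg hinv] at h1
  have h2 := hM.1.rent_nonneg hE.a_mem
  have h3 : ∀ i ∈ Finset.univ, ∫ p, M.q p.1 p.2 i * E.surplusDensity i p ∂E.joint ≤
      E.maxSurplus i := fun i _ => hM.1.integral_q_mul_surplusDensity_le hE (hreg i)
  have h4 : ∑ i, ∫ p, M.q p.1 p.2 i * E.surplusDensity i p ∂E.joint = ∑ i, E.maxSurplus i :=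
    le_antisymm (Finset.sum_le_sum h3) (by linarith)
  have h5 := (Finset.sum_eq_sum_iff_of_le h3).1 h4 j (Finset.mem_univ j)
  exact (integral_eq_iff_of_ae_le (hM.1.integrable_q_mul_surplusDensity hE (hreg j))
    (integrable_surplusDensity hE (hreg j)).pos_part (hM.1.q_mul_surplusDensity_le j)).1 h5

theorem IsOptimal.q_eq (hE : E.IsSmooth) (hreg : ∀ j, E.IsRegularMarginal j)
    (hinv : E.InvariantDependencies) {M : Mechanism (n + 1)} (hM : E.IsOptimal M)
    (j : Fin (n + 1)) :
    ∀ᵐ p : ℝ × (Fin (n + 1) → ℝ) ∂(volume.restrict (E.types ×ˢ E.values)),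
      0 < E.f p.1 p.2 → E.virtualValue j p.1 (p.2 j) ≠ 0 →
        M.q p.1 p.2 j = if 0 ≤ E.virtualValue j p.1 (p.2 j) then 1 else 0 := by
  rw [← joint_eq]
  filter_upwards [hM.q_mul_surplusDensity_eq hE hreg hinv j, E.ae_joint_mem] with p hq hp hf hφ
  have hne : E.surplusDensity j p ≠ 0 :=
    mul_ne_zero (mul_ne_zero hφ hf.ne') (hE.g_pos p.1 hp.1).ne'
  rw [← ite_mul_surplusDensity hE j hp] at hq
  exact mul_right_cancel₀ hne hq

end Optimal

end Environment

theorem theorem1 (n : ℕ) (E : Environment (n + 1)) (hE : E.IsSmooth)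
    (hreg : ∀ j, E.IsRegularMarginal j) (hinv : E.InvariantDependencies) :
    -- offering optimal one-good mechanisms separately is optimal
    (∀ M : Fin (n + 1) → Mechanism 1, (∀ j, (E.oneGood j).IsOptimal (M j)) →
      E.IsOptimal (Mechanism.separate M)) ∧
    -- optimal one-good mechanisms exist, and can be taken with allocation `1{φ^j ≥ 0}`
    (∃ M : Fin (n + 1) → Mechanism 1, ∀ j, (E.oneGood j).IsOptimal (M j) ∧
      ∀ γ ∈ E.types, ∀ θ ∈ (E.oneGood j).values,
        (M j).q γ θ 0 = if 0 ≤ E.virtualValue j γ (θ 0) then 1 else 0) ∧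
    -- every optimal joint mechanism has this allocation almost surely where `φ^j ≠ 0`
    (∀ M : Mechanism (n + 1), E.IsOptimal M → ∀ j,
      ∀ᵐ p : ℝ × (Fin (n + 1) → ℝ) ∂(volume.restrict (E.types ×ˢ E.values)),
        0 < E.f p.1 p.2 → E.virtualValue j p.1 (p.2 j) ≠ 0 →
          M.q p.1 p.2 j = if 0 ≤ E.virtualValue j p.1 (p.2 j) then 1 else 0) := by
  choose M hM _ hq using Environment.exists_optimal_oneGood hE hreg hinv
  exact ⟨fun M hM => Environment.isOptimal_separate hE hreg hinv hM,
    ⟨M, fun j => ⟨hM j, hq j⟩⟩, fun M hM j => hM.q_eq hE hreg hinv j⟩
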